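/- Let $k$ be a field, $n\ge 0$ an integer, and $Q$ the $n$-Kronecker quiver: two vertices, a source $1$ and a sink $2$, and $n$ arrows $\alpha_1,\dots,\alpha_n\colon 1\to 2$. A root of $Q$ is a nonzero vector $(x,y)\in\mathbb Z^2$ with $x^2+y^2-nxy\le 1$; it is called real if $x^2+y^2-nxy=1$ and imaginary otherwise, and positive if $x,y\ge 0$. Let $\widetilde Q$ be the universal covering of $Q$, that is, the $n$-regular tree with bipartite orientation (every vertex has exactly $n$ neighbours and is a source or a sink), whose arrows are labelled so that exactly one arrow over each $\alpha_i$ starts at each source and exactly one ends at each sink. The push-down $\pi(M)$ of a finite-dimensional representation $M$ of $\widetilde Q$ over $k$ is the representation of $Q$ with $\pi(M)_1=\bigoplus_{v \text{ source}}M_v$ and $\pi(M)_2=\bigoplus_{w\text{ sink}}M_w$, in which $\alpha_i$ acts on the summand $M_v$ as the map of $M$ along the arrow over $\alpha_i$ starting at $v$. A finite-dimensional representation $M$ is exceptional if it is indecomposable and $\operatorname{Ext}^1(M,M)=0$. A $kQ$-module $N$ is cover-exceptional if $N\cong\pi(M)$ for some exceptional finite-dimensional representation $M$ of $\widetilde Q$.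 Then for every positive imaginary root $(x,y)$ of $Q$ there are at least $n$ pairwise non-isomorphic cover-exceptional $kQ$-modules $N$ with $\dim_k N_1=x$ and $\dim_k N_2=y$. -/

import Mathlib

open CategoryTheory CategoryTheory.Limits
open scoped DirectSum

universe u

namespace Kronecker

/-! ### Representations of quivers -/

/-- The category of `k`-linear representations of a quiver `V`: a representation attaches a
vector space to each vertex and a linear map to each arrow, that is, it is a functor from the free
category on `V` to `k`-vector spaces; morphisms and exactness are vertexwise. -/
abbrev QuiverRep (k : Type u) [Field k] (V : Type) [Quiver.{0} V] :=
  Paths V ⥤ ModuleCat.{u} k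

section Representations

variable {k : Type u} [Field k] {V : Type} [Quiver.{0} V]

/-- The vector space attached to a vertex. -/
abbrev space (M : QuiverRep k V) (a : V) : ModuleCat.{u} k :=
  M.obj ((Paths.of V).obj a)

/-- The linear map attached to an arrow. -/
abbrev arrowMap (M : QuiverRep k V) {a b : V} (α : a ⟶ b) : space M a →ₗ[k] space M b :=
  (M.map ((Paths.of V).map α)).hom

/-- A representation of finite total dimension (the quiver may be infinite). -/
def IsFiniteDimensional (M : QuiverRep k V) : Prop :=
  (∀ a : V, FiniteDimensional k (space M a)) ∧ {a : V | Nontrivial (space M a)}.Finite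

/-- `Ext¹(M, M) = 0`: every short exact sequence `0 → M → E → M → 0` splits. -/
def HasNoSelfExtension (M : QuiverRep k V) : Prop :=
  ∀ S : ShortComplex (QuiverRep k V), S.ShortExact →
    Nonempty (S.X₁ ≅ M) → Nonempty (S.X₃ ≅ M) → Nonempty S.Splitting

/-- An exceptional module: finite-dimensional, indecomposable, without self-extensions. -/
def IsExceptional (M : QuiverRep k V) : Prop :=
  IsFiniteDimensional M ∧ Indecomposable M ∧ HasNoSelfExtension M

end Representations

/-! ### The Kronecker quiver -/

/-- The two vertices of the `n`-Kronecker quiver. -/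
inductive Vertex (n : ℕ) : Type
  | source
  | sink

/-- The arrows of the `n`-Kronecker quiver: `α i : source ⟶ sink` for `i : Fin n`. -/
inductive Arrow (n : ℕ) : Vertex n → Vertex n → Type
  | α (i : Fin n) : Arrow n Vertex.source Vertex.sink

instance (n : ℕ) : Quiver.{0} (Vertex n) where
  Hom := Arrow n

/-- The dimension vector of a representation of the `n`-Kronecker quiver. -/
noncomputable def dimVector {k : Type u} [Field k] {n : ℕ} (N : QuiverRep k (Vertex n)) : ℕ × ℕ :=
  (Module.finrank k (space N Vertex.source), Module.finrank k (space N Vertex.sink))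

/-! ### Roots -/

/-- The roots of the `n`-Kronecker quiver. -/
def IsRoot (n : ℕ) (x y : ℤ) : Prop :=
  (x, y) ≠ 0 ∧ x ^ 2 + y ^ 2 - n * x * y ≤ 1

/-- The real roots are those on which the quadratic form takes the value `1`. -/
def IsRealRoot (n : ℕ) (x y : ℤ) : Prop :=
  IsRoot n x y ∧ x ^ 2 + y ^ 2 - n * x * y = 1

/-- The positive imaginary roots. -/
def IsPositiveImaginaryRoot (n : ℕ) (x y : ℤ) : Prop :=
  IsRoot n x y ∧ ¬ IsRealRoot n x y ∧ 0 ≤ x ∧ 0 ≤ y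

/-! ### The universal covering of the Kronecker quiver -/

/-- Walk one step along the edge with label `i`: append `i` to the word, cancelling it if the
word already ends in `i`. The end of the word is the head of the list. -/
def stepWord {n : ℕ} (i : Fin n) : List (Fin n) → List (Fin n)
  | [] => [i]
  | j :: t => if i = j then t else i :: j :: t

theorem isChain_stepWord {n : ℕ} (i : Fin n) (w : List (Fin n)) (hw : w.IsChain (· ≠ ·)) :
    (stepWord i w).IsChain (· ≠ ·) := by
  cases w with
  | nil => simp [stepWord]
  | cons j t =>
    by_cases h : i = j
    · simpa [stepWord, h] using hw.tail
    · simpa [stepWord, h] using hw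

theorem even_length_stepWord {n : ℕ} (i : Fin n) (w : List (Fin n)) :
    Even (stepWord i w).length ↔ ¬ Even w.length := by
  cases w with
  | nil => simp [stepWord]
  | cons j t =>
    by_cases h : i = j <;> simp [stepWord, h, Nat.even_add_one]

/-- The vertices of the `n`-regular tree: reduced words in the labels of the arrows, that is,
reduced walks in the tree starting at a base vertex (the empty word). -/
@[ext]
structure CoverVertex (n : ℕ) : Type where
  word : List (Fin n)
  reduced : word.IsChain (· ≠ ·)
  deriving DecidableEq

/-- The endpoint of the edge with label `i` at the vertex `v`. -/
def CoverVertex.step {n : ℕ} (v : CoverVertex n) (i : Fin n) : CoverVertex n :=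
  ⟨stepWord i v.word, isChain_stepWord i v.word v.reduced⟩

/-- The vertices over the source of the Kronecker quiver. -/
abbrev CoverSource (n : ℕ) : Type :=
  {v : CoverVertex n // Even v.word.length}

/-- The vertices over the sink of the Kronecker quiver. -/
abbrev CoverSink (n : ℕ) : Type :=
  {v : CoverVertex n // ¬ Even v.word.length}

/-- The endpoint of the arrow over `α i` that starts at the source `v`. -/
def CoverSource.step {n : ℕ} (v : CoverSource n) (i : Fin n) : CoverSink n :=
  ⟨v.1.step i, fun h => (even_length_stepWord i v.1.word).1 h v.2⟩

/-- The arrows of the `n`-regular tree with bipartite orientation: for each `i`, exactly one arrow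
over `α i` starts at each source (and exactly one ends at each sink). -/
inductive CoverArrow (n : ℕ) : CoverVertex n → CoverVertex n → Type
  | lift (v : CoverSource n) (i : Fin n) : CoverArrow n v.1 (v.step i).1

/-- The universal covering of the `n`-Kronecker quiver. -/
instance (n : ℕ) : Quiver.{0} (CoverVertex n) where
  Hom := CoverArrow n

/-- The arrow over `α i` that starts at the source `v`. -/
def liftArrow {n : ℕ} (v : CoverSource n) (i : Fin n) : v.1 ⟶ (v.step i).1 :=
  CoverArrow.lift v i

/-! ### The push-down functor -/

section PushDown

variable {k : Type u} [Field k] {n : ℕ}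

/-- The spaces of the push-down of `M`: the direct sum of the spaces of `M` over the fibre. -/
noncomputable def pushDownSpace (M : QuiverRep k (CoverVertex n)) : Vertex n → ModuleCat.{u} k
  | .source => ModuleCat.of k (⨁ v : CoverSource n, space M v.1)
  | .sink => ModuleCat.of k (⨁ v : CoverSink n, space M v.1)

/-- The maps of the push-down of `M`: `α i` restricted to the summand `M v` is the map of `M`
along the arrow over `α i` that starts at `v`. -/
noncomputable def pushDownMap (M : QuiverRep k (CoverVertex n)) :
    {a b : Vertex n} → (a ⟶ b) → (pushDownSpace M a ⟶ pushDownSpace M b)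
  | _, _, .α i => ModuleCat.ofHom <|
      DirectSum.toModule k (CoverSource n) (⨁ v : CoverSink n, space M v.1) fun v =>
        (DirectSum.lof k (CoverSink n) (fun w => space M w.1) (v.step i)).comp
          (arrowMap M (liftArrow v i))

/-- The push-down `π(M)` of a representation of the universal covering. -/
noncomputable def pushDown (M : QuiverRep k (CoverVertex n)) : QuiverRep k (Vertex n) :=
  Paths.lift { obj := pushDownSpace M, map := pushDownMap M }

/-- `N` is cover-exceptional if it is (isomorphic to) the push-down of an exceptional
representation of the universal covering. -/
def IsCoverExceptional (N : QuiverRep k (Vertex n)) : Prop :=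
  ∃ M : QuiverRep k (CoverVertex n), IsExceptional M ∧ Nonempty (N ≅ pushDown M)

end PushDown

end Kronecker

set_option linter.unusedSectionVars false

namespace Kronecker

/-! ### Graded matrices -/

/-! A Kronecker module is handled as a tuple of matrices `α i`, and a lift to the covering as a
grading of the two bases by vertices of the tree such that `α i` moves degrees along the edges with
label `i`. Exceptionality of the lift becomes matrix algebra (`IsExceptionalGrading`):
degree-preserving endomorphisms are scalars, and every homogeneous tuple is a coboundary `ψ * α i -
α i * φ`.

Two operations preserve such gradings and non-isomorphy. Transposition exchanges `x` and `y` and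
flips the parity of the degrees. Reflection views the `y` rows of `α` as vectors of `kⁿ ⊗ X` and
replaces them by a homogeneous basis of their orthogonal complement, so `(x, y)` becomes `(x, n x -
y)`. This is a reflection functor followed by duality, hence the grading of `X` survives unchanged
(`IsReflection.isExceptionalGrading`, `exists_isReflection`).

The quadratic form is invariant under both. As long as `n x < 2 y` or `n y < 2 x`, one of the
coordinates can be made smaller, so induction on `x + y` (`hasExceptionalFamily`) leads to `2 y ≤ n
x` and `2 x ≤ n y`, and by transposition to `x ≤ y`. There the modules are explicit: caterpillar
trees in the covering with a line at each vertex. Connectedness makes graded endomorphisms scalar,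
and absence of cycles makes every function on the edges a difference of potentials
(`isExceptionalGrading_caterpillar`). The set of labels `l` with `α l` injective tells `n` of them
apart.

Finally `gradedRep` turns a graded module into an exceptional representation of the covering, and
`exists_pushDown_bases` recovers the matrices `α` from its push-down. -/

theorem stepWord_stepWord {n : ℕ} (i : Fin n) (w : List (Fin n)) (hw : w.IsChain (· ≠ ·)) :
    stepWord i (stepWord i w) = w := by
  match w, hw with
  | [], _ => simp [stepWord]
  | [j], _ => by_cases h : i = j <;> simp [stepWord, h]
  | j :: l :: t, hw =>
    have hjl : j ≠ l := by simpa using hw.rel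
    by_cases h : i = j
    · subst h; simp [stepWord, hjl]
    · simp [stepWord, h]

theorem CoverVertex.step_step {n : ℕ} (v : CoverVertex n) (i : Fin n) : (v.step i).step i = v :=
  CoverVertex.ext (stepWord_stepWord i v.word v.reduced)

section Matrices

variable {k : Type u} [Field k] {n : ℕ}
variable {X Y Z : Type} [Fintype X] [Fintype Y] [Fintype Z]
  [DecidableEq X] [DecidableEq Y] [DecidableEq Z]

/-- A family of matrices is homogeneous for gradings by the vertices of the covering if the `i`-th
matrix moves degrees along the edges with label `i`. -/
def IsHomogeneous (σ : X → CoverVertex n) (τ : Y → CoverVertex n) (α : Fin n → Matrix Y X k) :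
    Prop :=
  ∀ i y x, α i y x ≠ 0 → τ y = (σ x).step i

/-- A matrix is graded if it preserves degrees. -/
def IsGraded (σ : X → CoverVertex n) (τ : Y → CoverVertex n) (φ : Matrix X Y k) : Prop :=
  ∀ x y, φ x y ≠ 0 → σ x = τ y

/-- The part of degree zero of a matrix. -/
def gradedPart (σ : X → CoverVertex n) (τ : Y → CoverVertex n) (φ : Matrix X Y k) :
    Matrix X Y k :=
  Matrix.of fun x y => if σ x = τ y then φ x y else 0

/-- The homogeneous part of a family of matrices. -/
def homogeneousPart (σ : X → CoverVertex n) (τ : Y → CoverVertex n) (α : Fin n → Matrix Y X k) :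
    Fin n → Matrix Y X k :=
  fun i => Matrix.of fun y x => if τ y = (σ x).step i then α i y x else 0

theorem isGraded_gradedPart (σ : X → CoverVertex n) (τ : Y → CoverVertex n) (φ : Matrix X Y k) :
    IsGraded σ τ (gradedPart σ τ φ) := by
  intro x y h
  by_contra h'
  simp [gradedPart, h'] at h

theorem isHomogeneous_homogeneousPart (σ : X → CoverVertex n) (τ : Y → CoverVertex n)
    (α : Fin n → Matrix Y X k) : IsHomogeneous σ τ (homogeneousPart σ τ α) := by
  intro i y x h
  by_contra h'
  simp [homogeneousPart, h'] at h

theorem IsGraded.transpose {σ : X → CoverVertex n} {τ : Y → CoverVertex n} {φ : Matrix X Y k}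
    (h : IsGraded σ τ φ) : IsGraded τ σ φ.transpose :=
  fun y x hyx => (h x y hyx).symm

theorem IsHomogeneous.transpose {σ : X → CoverVertex n} {τ : Y → CoverVertex n}
    {α : Fin n → Matrix Y X k} (h : IsHomogeneous σ τ α) :
    IsHomogeneous τ σ fun i => (α i).transpose := by
  intro i x y hxy
  rw [h i y x hxy, CoverVertex.step_step]

theorem IsHomogeneous.mul_isGraded {σ : X → CoverVertex n} {τ : Y → CoverVertex n}
    {α : Fin n → Matrix Y X k} (h : IsHomogeneous σ τ α) {φ : Matrix X X k}
    (hφ : IsGraded σ σ φ) : IsHomogeneous σ τ fun i => α i * φ := by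
  intro i y x hyx
  obtain ⟨z, -, hz⟩ := Finset.exists_ne_zero_of_sum_ne_zero hyx
  rw [h i y z (left_ne_zero_of_mul hz), hφ z x (right_ne_zero_of_mul hz)]

theorem IsGraded.mul_isHomogeneous {σ : X → CoverVertex n} {τ : Y → CoverVertex n}
    {ζ : Z → CoverVertex n} {α : Fin n → Matrix Y X k} (h : IsHomogeneous σ τ α)
    {γ : Matrix Z Y k} (hγ : IsGraded ζ τ γ) : IsHomogeneous σ ζ fun i => γ * α i := by
  intro i y x hyx
  obtain ⟨z, -, hz⟩ := Finset.exists_ne_zero_of_sum_ne_zero hyx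
  rw [hγ y z (left_ne_zero_of_mul hz), h i z x (right_ne_zero_of_mul hz)]

/-- Comparing homogeneous components: a solution `γ` of a linear system with homogeneous data may be
replaced by its part of degree zero. This lets exactness be stated without gradings. -/
theorem gradedPart_mul {σ : X → CoverVertex n} {τ : Y → CoverVertex n}
    {ζ : Z → CoverVertex n} {α : Fin n → Matrix Y X k} (h : IsHomogeneous σ τ α)
    {γ : Matrix Z Y k} {ν : Fin n → Matrix Z X k} (hν : IsHomogeneous σ ζ ν)
    (hγ : ∀ i, γ * α i = ν i) (i : Fin n) : gradedPart ζ τ γ * α i = ν i := by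
  ext z x
  rw [← hγ i]
  by_cases hz : ζ z = (σ x).step i
  · refine Finset.sum_congr rfl fun y _ => ?_
    by_cases hy : α i y x = 0
    · simp [hy]
    · simp [gradedPart, hz, h i y x hy]
  · have h1 : (γ * α i) z x = 0 := by rw [hγ i]; exact not_not.1 (mt (hν i z x) hz)
    rw [h1]
    refine Finset.sum_eq_zero fun y _ => ?_
    by_cases hy : α i y x = 0
    · simp [hy]
    · have : ζ z ≠ τ y := by rw [h i y x hy]; exact hz
      simp [gradedPart, this]

theorem sum_homogeneousPart_mul_transpose {σ : X → CoverVertex n} {τ : Y → CoverVertex n}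
    {α : Fin n → Matrix Y X k} (h : IsHomogeneous σ τ α) {γ : Fin n → Matrix Y X k}
    (hγ : ∑ i, γ i * (α i).transpose = 1) :
    ∑ i, homogeneousPart σ τ γ i * (α i).transpose = 1 := by
  ext y y'
  have h1 := congrFun (congrFun hγ y) y'
  rw [Matrix.sum_apply] at h1 ⊢
  have key : ∀ i x, homogeneousPart σ τ γ i y x * (α i).transpose x y' =
      if τ y = τ y' then γ i y x * (α i).transpose x y' else 0 := by
    intro i x
    by_cases hx : α i y' x = 0
    · simp [hx]
    · rw [h i y' x hx]; simp [homogeneousPart]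
  simp only [Matrix.mul_apply, key] at h1 ⊢
  by_cases hy : τ y = τ y'
  · simpa [hy] using h1
  · have : y ≠ y' := fun e => hy (by rw [e])
    simp [hy, this]

/-- A graded module for the Kronecker quiver with scalar graded endomorphisms and without graded
self-extensions, the degrees of the basis of the space at the source having parity `ε`. -/
structure IsExceptionalGrading (ε : Prop) (α : Fin n → Matrix Y X k) (σ : X → CoverVertex n)
    (τ : Y → CoverVertex n) : Prop where
  even_source : ∀ x, Even (σ x).word.length ↔ ε
  even_sink : ∀ y, Even (τ y).word.length ↔ ¬ ε
  homogeneous : IsHomogeneous σ τ α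
  brick : ∀ (φ : Matrix X X k) (ψ : Matrix Y Y k), IsGraded σ σ φ → IsGraded τ τ ψ →
    (∀ i, ψ * α i = α i * φ) → ∃ c : k, φ = c • 1 ∧ ψ = c • 1
  rigid : ∀ β : Fin n → Matrix Y X k, IsHomogeneous σ τ β →
    ∃ (φ : Matrix X X k) (ψ : Matrix Y Y k), IsGraded σ σ φ ∧ IsGraded τ τ ψ ∧
      ∀ i, β i = ψ * α i - α i * φ

/-- Isomorphy of modules for the Kronecker quiver given by matrices. -/
def MatrixIso (α β : Fin n → Matrix Y X k) : Prop :=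
  ∃ (φ : Matrix X X k) (ψ : Matrix Y Y k), IsUnit φ ∧ IsUnit ψ ∧ ∀ i, ψ * α i = β i * φ

theorem IsExceptionalGrading.transpose {ε : Prop} {α : Fin n → Matrix Y X k}
    {σ : X → CoverVertex n} {τ : Y → CoverVertex n} (h : IsExceptionalGrading ε α σ τ) :
    IsExceptionalGrading (¬ ε) (fun i => (α i).transpose) τ σ where
  even_source := h.even_sink
  even_sink x := by rw [not_not]; exact h.even_source x
  homogeneous := h.homogeneous.transpose
  brick ψ φ hψ hφ hc := by
    obtain ⟨c, h1, h2⟩ := h.brick φ.transpose ψ.transpose hφ.transpose hψ.transpose fun i => by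
      simpa [Matrix.transpose_mul] using (congrArg Matrix.transpose (hc i)).symm
    refine ⟨c, ?_, ?_⟩
    · simpa using congrArg Matrix.transpose h2
    · simpa using congrArg Matrix.transpose h1
  rigid β hβ := by
    obtain ⟨φ, ψ, hφ, hψ, hc⟩ := h.rigid _ hβ.transpose
    refine ⟨-ψ.transpose, -φ.transpose, ?_, ?_, fun i => ?_⟩
    · intro x y hxy
      exact hψ.transpose x y (by simpa using hxy)
    · intro x y hxy
      exact hφ.transpose x y (by simpa using hxy)
    · have := congrArg Matrix.transpose (hc i)
      simp only [Matrix.transpose_transpose, Matrix.transpose_sub, Matrix.transpose_mul] at this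
      rw [this, Matrix.neg_mul, Matrix.mul_neg]
      abel

theorem MatrixIso.transpose {α β : Fin n → Matrix Y X k}
    (h : MatrixIso (fun i => (α i).transpose) fun i => (β i).transpose) : MatrixIso β α := by
  obtain ⟨ψ, φ, hψ, hφ, hc⟩ := h
  refine ⟨φ.transpose, ψ.transpose, by simpa using hφ, by simpa using hψ, fun i => ?_⟩
  simpa [Matrix.transpose_mul] using (congrArg Matrix.transpose (hc i)).symm

/-! ### Reflections -/

/-- The hypothesis says that the rows of `α`, as vectors indexed by pairs `(i, x)`, are independent;
a left inverse of the row map supplies `γ`. -/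
theorem exists_sum_mul_transpose_eq_one {α : Fin n → Matrix Y X k}
    (h : ∀ ψ : Y → k, (∀ i, Matrix.vecMul ψ (α i) = 0) → ψ = 0) :
    ∃ γ : Fin n → Matrix Y X k, ∑ i, γ i * (α i).transpose = 1 := by
  let A : Matrix Y (Fin n × X) k := Matrix.of fun y u => α u.1 y u.2
  have hA : LinearMap.ker A.vecMulLinear = ⊥ := by
    refine LinearMap.ker_eq_bot'.2 fun ψ hψ => h ψ fun i => ?_
    ext x
    exact congrFun hψ (i, x)
  obtain ⟨S, hS⟩ := LinearMap.exists_leftInverse_of_injective _ hA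
  refine ⟨fun i => Matrix.of fun y x => S (Pi.single (i, x) 1) y, ?_⟩
  ext y y'
  have h1 := congrFun (LinearMap.congr_fun hS (Pi.single y' 1)) y
  have h2 : A.vecMulLinear (Pi.single y' 1) = ∑ u, A y' u • Pi.single u (1 : k) := by
    ext u
    simp [Finset.sum_apply, Pi.single_apply]
  rw [LinearMap.comp_apply, h2, map_sum, Finset.sum_apply, Fintype.sum_prod_type] at h1
  rw [Matrix.sum_apply]
  simp only [Matrix.mul_apply, Matrix.transpose_apply, Matrix.of_apply]
  convert h1 using 1
  · refine Finset.sum_congr rfl fun i _ => Finset.sum_congr rfl fun x _ => ?_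
    simp [A, mul_comm]
  · simp [Matrix.one_apply, Pi.single_apply]

/-- The rows of `α` and the rows of `β` are bases of orthogonal complements in `kⁿ ⊗ X`. -/
structure IsReflection (α : Fin n → Matrix Y X k) (β : Fin n → Matrix Z X k) : Prop where
  pairing : ∑ i, α i * (β i).transpose = 0
  left_inverse : ∃ γ : Fin n → Matrix Y X k, ∑ i, γ i * (α i).transpose = 1
  right_inverse : ∃ γ : Fin n → Matrix Z X k, ∑ i, γ i * (β i).transpose = 1
  left_exact : ∀ ν : Fin n → X → k, ∑ i, Matrix.mulVec (β i) (ν i) = 0 →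
    ∃ ψ : Y → k, ∀ i, Matrix.vecMul ψ (α i) = ν i
  right_exact : ∀ ν : Fin n → X → k, ∑ i, Matrix.mulVec (α i) (ν i) = 0 →
    ∃ ψ : Z → k, ∀ i, Matrix.vecMul ψ (β i) = ν i

theorem IsReflection.symm {α : Fin n → Matrix Y X k} {β : Fin n → Matrix Z X k}
    (h : IsReflection α β) : IsReflection β α where
  pairing := by
    simpa [Matrix.transpose_sum, Matrix.transpose_mul] using congrArg Matrix.transpose h.pairing
  left_inverse := h.right_inverse
  right_inverse := h.left_inverse
  left_exact := h.right_exact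
  right_exact := h.left_exact

theorem IsReflection.exists_mul_eq {W : Type} [Fintype W] {α : Fin n → Matrix Y X k}
    {β : Fin n → Matrix Z X k} (h : IsReflection α β) {ν : Fin n → Matrix W X k}
    (hν : ∑ i, ν i * (β i).transpose = 0) : ∃ ψ : Matrix W Y k, ∀ i, ψ * α i = ν i := by
  have : ∀ w, ∃ ψ : Y → k, ∀ i, Matrix.vecMul ψ (α i) = ν i w := fun w => h.left_exact _ (by
    ext z
    have := congrFun (congrFun hν w) z
    rw [Matrix.sum_apply] at this
    simpa [Matrix.mul_apply, Matrix.mulVec, dotProduct, mul_comm] using this)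
  choose ψ hψ using this
  exact ⟨Matrix.of ψ, fun i => by ext w x; exact congrFun (hψ w i) x⟩

theorem eq_of_mul_eq_mul {W : Type} [Fintype W] {α : Fin n → Matrix Y X k}
    (h : ∃ γ : Fin n → Matrix Y X k, ∑ i, γ i * (α i).transpose = 1) {ψ ψ' : Matrix W Y k}
    (hψ : ∀ i, ψ * α i = ψ' * α i) : ψ = ψ' := by
  obtain ⟨γ, hγ⟩ := h
  have h1 : ∑ i, α i * (γ i).transpose = 1 := by
    simpa [Matrix.transpose_sum, Matrix.transpose_mul] using congrArg Matrix.transpose hγ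
  rw [← Matrix.mul_one ψ, ← Matrix.mul_one ψ', ← h1, Matrix.mul_sum, Matrix.mul_sum]
  exact Finset.sum_congr rfl fun i _ => by rw [← Matrix.mul_assoc, hψ, Matrix.mul_assoc]

theorem IsReflection.isExceptionalGrading {ε : Prop} {α : Fin n → Matrix Y X k}
    {β : Fin n → Matrix Z X k} (h : IsReflection α β) {σ : X → CoverVertex n}
    {τ : Y → CoverVertex n} {ζ : Z → CoverVertex n} (hα : IsExceptionalGrading ε α σ τ)
    (hβ : IsHomogeneous σ ζ β) (hζ : ∀ z, Even (ζ z).word.length ↔ ¬ ε) :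
    IsExceptionalGrading ε β σ ζ where
  even_source := hα.even_source
  even_sink := hζ
  homogeneous := hβ
  brick φ ψ hφ hψ hc := by
    -- Reflection is contravariant on `X`: an endomorphism `φ` of `β` acts on the side of `α` as its
    -- transpose. Orthogonality to `β` lets it extend to an endomorphism of `α`.
    have h1 : ∑ i, α i * φ.transpose * (β i).transpose = 0 := by
      have : ∑ i, ψ * β i * (α i).transpose = 0 := by
        simp only [Matrix.mul_assoc, ← Matrix.mul_sum, h.symm.pairing, Matrix.mul_zero]
      simpa [hc, Matrix.transpose_sum, Matrix.transpose_mul, Matrix.mul_assoc] using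
        congrArg Matrix.transpose this
    obtain ⟨χ, hχ⟩ := h.exists_mul_eq h1
    have hhom := hα.homogeneous.mul_isGraded hφ.transpose
    obtain ⟨c, h2, -⟩ := hα.brick φ.transpose _ hφ.transpose (isGraded_gradedPart τ τ χ)
      (gradedPart_mul hα.homogeneous hhom hχ)
    have h3 : φ = c • 1 := by simpa using congrArg Matrix.transpose h2
    refine ⟨c, h3, eq_of_mul_eq_mul h.right_inverse fun i => ?_⟩
    rw [hc, h3]
    simp
  rigid δ hδ := by
    obtain ⟨γ, hγ⟩ := h.left_inverse
    have hγ' := sum_homogeneousPart_mul_transpose hα.homogeneous hγ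
    obtain ⟨γ', hγ1, hγ2⟩ : ∃ γ', IsHomogeneous σ τ γ' ∧ ∑ i, γ' i * (α i).transpose = 1 :=
      ⟨_, isHomogeneous_homogeneousPart σ τ γ, hγ'⟩
    obtain ⟨γ₂, hγ₂⟩ := h.right_inverse
    have hγ₂' := sum_homogeneousPart_mul_transpose hβ hγ₂
    obtain ⟨η, hη1, hη2⟩ : ∃ η, IsHomogeneous σ ζ η ∧ ∑ i, η i * (β i).transpose = 1 :=
      ⟨_, isHomogeneous_homogeneousPart σ ζ γ₂, hγ₂'⟩
    -- `θ` is the failure of `δ` to be orthogonal to `α`. The section `η` turns it into the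
    -- homogeneous tuple `θ * η i`, which rigidity of `α` writes as a coboundary. The resulting `φ`
    -- corrects `δ` to a tuple orthogonal to `α`, that is, to one of the form `χ * β i`.
    let θ : Matrix Y Z k := ∑ i, α i * (δ i).transpose
    have hθ : IsGraded τ ζ θ := by
      intro y z hyz
      simp only [θ, Matrix.sum_apply] at hyz
      obtain ⟨i, -, hi⟩ := Finset.exists_ne_zero_of_sum_ne_zero hyz
      obtain ⟨x, -, hx⟩ := Finset.exists_ne_zero_of_sum_ne_zero hi
      rw [hα.homogeneous i y x (left_ne_zero_of_mul hx), hδ i z x (right_ne_zero_of_mul hx)]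
    obtain ⟨φ, ψ, hφ, hψ, hc⟩ := hα.rigid _ (hθ.mul_isHomogeneous hη1)
    have h1 : ∑ i, α i * φ * (β i).transpose = - θ := by
      have h2 : ∑ i, θ * η i * (β i).transpose = θ := by
        simp only [Matrix.mul_assoc, ← Matrix.mul_sum, hη2, Matrix.mul_one]
      have h3 : ∑ i, ψ * α i * (β i).transpose = 0 := by
        simp only [Matrix.mul_assoc, ← Matrix.mul_sum, h.pairing, Matrix.mul_zero]
      simp only [hc, Matrix.sub_mul, Finset.sum_sub_distrib, h3, zero_sub] at h2
      rw [← h2, neg_neg]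
    have h2 : ∑ i, (δ i + β i * φ.transpose) * (α i).transpose = 0 := by
      have := congrArg Matrix.transpose h1
      simp only [Matrix.transpose_sum, Matrix.transpose_mul, Matrix.transpose_transpose,
        Matrix.transpose_neg, θ] at this
      simp only [Matrix.add_mul, Finset.sum_add_distrib, Matrix.mul_assoc, this]
      simp
    obtain ⟨χ, hχ⟩ := h.symm.exists_mul_eq h2
    have hhom : IsHomogeneous σ ζ fun i => δ i + β i * φ.transpose := by
      intro i z x hzx
      by_contra hne
      have h3 : δ i z x = 0 := not_not.1 (mt (hδ i z x) hne)
      have h4 : (β i * φ.transpose) z x = 0 :=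
        not_not.1 (mt (hβ.mul_isGraded hφ.transpose i z x) hne)
      exact hzx (by simp only [Matrix.add_apply, h3, h4, add_zero])
    refine ⟨φ.transpose, _, hφ.transpose, isGraded_gradedPart ζ ζ χ, fun i => ?_⟩
    rw [gradedPart_mul hβ hhom hχ]
    simp

/-- Reflecting twice returns to the start, so non-isomorphic modules have non-isomorphic
reflections. The extension `χ` of the transposed isomorphism is square, so a right inverse suffices.
-/
theorem IsReflection.matrixIso {α α' : Fin n → Matrix Y X k} {β β' : Fin n → Matrix Z X k}
    (h : IsReflection α β) (h' : IsReflection α' β') (hi : MatrixIso β β') : MatrixIso α' α := by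
  obtain ⟨φ, ψ, hφ, hψ, hc⟩ := hi
  have h1 : ∑ i, α i * φ.transpose * (β' i).transpose = 0 := by
    have : ∑ i, ψ * β i * (α i).transpose = 0 := by
      simp only [Matrix.mul_assoc, ← Matrix.mul_sum, h.symm.pairing, Matrix.mul_zero]
    simpa [hc, Matrix.transpose_sum, Matrix.transpose_mul, Matrix.mul_assoc] using
      congrArg Matrix.transpose this
  obtain ⟨χ, hχ⟩ := h'.exists_mul_eq h1
  have hφ' : IsUnit φ.transpose := by simpa using hφ
  refine ⟨φ.transpose, χ, hφ', ?_, hχ⟩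
  obtain ⟨f, hf⟩ := hφ'.exists_right_inv
  obtain ⟨γ, hγ⟩ := h.left_inverse
  have h2 : ∑ i, α i * (γ i).transpose = 1 := by
    simpa [Matrix.transpose_sum, Matrix.transpose_mul] using congrArg Matrix.transpose hγ
  have h3 : χ * ∑ i, α' i * f * (γ i).transpose = 1 := by
    rw [Matrix.mul_sum, ← h2]
    refine Finset.sum_congr rfl fun i _ => ?_
    rw [← Matrix.mul_assoc, ← Matrix.mul_assoc, hχ, Matrix.mul_assoc (α i), hf, Matrix.mul_one]
  exact IsUnit.of_mul_eq_one _ h3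

/-- A relation `ψ` among the rows of `α` yields endomorphisms that vanish on `X`. As `X` is
nonempty, their scalar is zero, which forces `ψ = 0`. -/
theorem IsExceptionalGrading.exists_left_inverse {ε : Prop} [Nonempty X]
    {α : Fin n → Matrix Y X k} {σ : X → CoverVertex n} {τ : Y → CoverVertex n}
    (h : IsExceptionalGrading ε α σ τ) :
    ∃ γ : Fin n → Matrix Y X k, ∑ i, γ i * (α i).transpose = 1 := by
  refine exists_sum_mul_transpose_eq_one fun ψ hψ => ?_
  by_contra hne
  obtain ⟨y₀, hy₀⟩ := Function.ne_iff.1 hne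
  let χ : Matrix Y Y k := Matrix.of fun y y' => if y = y₀ then ψ y' else 0
  have hχ : ∀ i, χ * α i = (0 : Fin n → Matrix Y X k) i := by
    intro i
    ext y x
    by_cases hy : y = y₀
    · simpa [χ, hy, Matrix.mul_apply, Matrix.vecMul, dotProduct] using congrFun (hψ i) x
    · simp [χ, hy, Matrix.mul_apply]
  have hz : IsHomogeneous σ τ (0 : Fin n → Matrix Y X k) := fun i y x h => (h rfl).elim
  obtain ⟨c, h1, h2⟩ := h.brick 0 _ (fun _ _ h => (h rfl).elim) (isGraded_gradedPart τ τ χ)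
    fun i => by rw [gradedPart_mul h.homogeneous hz hχ]; simp
  obtain ⟨x⟩ := ‹Nonempty X›
  have hc : c = 0 := by simpa using (congrFun (congrFun h1 x) x).symm
  apply hy₀
  simpa [hc, gradedPart, χ] using congrFun (congrFun h2 y₀) y₀

theorem exists_isReflection {ε : Prop} {x y : ℕ} {α : Fin n → Matrix (Fin y) (Fin x) k}
    {σ : Fin x → CoverVertex n} {τ : Fin y → CoverVertex n} (hσ : ∀ a, Even (σ a).word.length ↔ ε)
    (h : IsHomogeneous σ τ α) (hl : ∃ γ : Fin n → Matrix (Fin y) (Fin x) k,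
      ∑ i, γ i * (α i).transpose = 1) {z : ℕ} (hz : y + z = n * x) :
    ∃ (β : Fin n → Matrix (Fin z) (Fin x) k) (ζ : Fin z → CoverVertex n),
      IsReflection α β ∧ IsHomogeneous σ ζ β ∧ ∀ b, Even (ζ b).word.length ↔ ¬ ε := by
  classical
  obtain ⟨γ, hγ⟩ := hl
  have hγ' : ∑ i, α i * (γ i).transpose = 1 := by
    simpa [Matrix.transpose_sum, Matrix.transpose_mul] using congrArg Matrix.transpose hγ
  let A : Matrix (Fin y) (Fin n × Fin x) k := Matrix.of fun b u => α u.1 b u.2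
  let K := LinearMap.ker A.mulVecLin
  let deg : Fin n × Fin x → CoverVertex n := fun u => (σ u.2).step u.1
  have hA : ∀ f : Fin n × Fin x → k,
      A.mulVec f = ∑ i, Matrix.mulVec (α i) fun a => f (i, a) := by
    intro f
    ext b
    simp [A, Matrix.mulVec, dotProduct, Fintype.sum_prod_type, Finset.sum_apply]
  have hsurj : LinearMap.range A.mulVecLin = ⊤ := by
    refine LinearMap.range_eq_top.2 fun w => ⟨fun u => Matrix.vecMul w (γ u.1) u.2, ?_⟩
    rw [Matrix.mulVecLin_apply, hA]
    have : ∀ i, Matrix.mulVec (α i) (fun a => Matrix.vecMul w (γ i) a) =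
        Matrix.mulVec (α i * (γ i).transpose) w := fun i => by
      rw [← Matrix.mulVec_mulVec, Matrix.mulVec_transpose]
    simp only [this]
    rw [← Matrix.sum_mulVec, hγ', Matrix.one_mulVec]
  have hK : Module.finrank k K = z := by
    have := LinearMap.finrank_range_add_finrank_ker A.mulVecLin
    rw [hsurj, finrank_top] at this
    simp only [Module.finrank_fintype_fun_eq_card, Fintype.card_prod, Fintype.card_fin] at this
    change y + Module.finrank k K = _ at this
    omega
  -- The homogeneous vectors of the kernel. The degree is required to be that of some `u₀`, so that
  -- the new basis vectors get degrees adjacent to the `σ a`, hence of the right parity.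
  let s : Set (Fin n × Fin x → k) := {f | f ∈ K ∧ ∃ u₀, ∀ u, f u ≠ 0 → deg u₀ = deg u}
  have hs : Submodule.span k s = K := by
    refine le_antisymm (Submodule.span_le.2 fun f hf => hf.1) fun f hf => ?_
    let comp : CoverVertex n → Fin n × Fin x → k := fun g u => if deg u = g then f u else 0
    have hf' : f = ∑ g ∈ Finset.univ.image deg, comp g := by
      ext u
      simp [comp, Finset.sum_apply]
    rw [hf']
    -- Each row of `A` is supported in a single degree, so the homogeneous components of a kernel
    -- vector lie in the kernel.
    refine Submodule.sum_mem _ fun g hg => Submodule.subset_span ⟨?_, ?_⟩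
    · change A.mulVec (comp g) = 0
      ext b
      have h1 : A.mulVec f b = 0 := congrFun (LinearMap.mem_ker.1 hf) b
      have h2 : ∀ u, A b u * comp g u = if τ b = g then A b u * f u else 0 := by
        intro u
        by_cases hu : A b u = 0
        · simp [hu]
        · have : τ b = deg u := h _ _ _ hu
          rw [this]
          simp [comp]
      simp only [Matrix.mulVec, dotProduct, h2] at h1 ⊢
      by_cases hb : τ b = g <;> simp [hb, h1]
    · obtain ⟨u₀, -, rfl⟩ := Finset.mem_image.1 hg
      refine ⟨u₀, fun u hu => ?_⟩
      by_contra hne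
      exact hu (by simp [comp, Ne.symm hne])
  obtain ⟨b, hbs, hspan, hli⟩ := exists_linearIndependent k s
  rw [hs] at hspan
  have : Finite b := hli.finite
  have : Fintype b := Fintype.ofFinite b
  have hcard : Fintype.card b = z := by
    rw [← hK, ← hspan, finrank_span_set_eq_card hli, Set.toFinset_card]
  let e : b ≃ Fin z := Fintype.equivFinOfCardEq hcard
  choose u₀ hu₀ using fun c : b => (hbs c.2).2
  let β : Fin n → Matrix (Fin z) (Fin x) k := fun i => Matrix.of fun c a => (e.symm c).1 (i, a)
  have hpair : ∀ c, ∑ i, Matrix.mulVec (α i) (β i c) = 0 := fun c => by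
    rw [← show A.mulVec (e.symm c).1 = 0 from (hbs (e.symm c).2).1, hA]
    rfl
  have hexact : ∀ ν : Fin n → Fin x → k, ∑ i, Matrix.mulVec (α i) (ν i) = 0 →
      ∃ ψ : Fin z → k, ∀ i, Matrix.vecMul ψ (β i) = ν i := by
    intro ν hν
    have h1 : (fun u : Fin n × Fin x => ν u.1 u.2) ∈ Submodule.span k (Set.range fun c =>
        (e.symm c).1) := by
      have : Set.range (fun c => (e.symm c).1) = b := by
        rw [show (fun c => (e.symm c).1) = Subtype.val ∘ e.symm from rfl,
          e.symm.surjective.range_comp, Subtype.range_coe]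
      rw [this, hspan]
      change A.mulVec _ = 0
      rw [hA, ← hν]
    obtain ⟨ψ, hψ⟩ := (Submodule.mem_span_range_iff_exists_fun k).1 h1
    refine ⟨ψ, fun i => ?_⟩
    ext a
    have := congrFun hψ (i, a)
    simpa [Finset.sum_apply, Matrix.vecMul, dotProduct, β] using this
  refine ⟨β, fun c => deg (u₀ (e.symm c)), ⟨?_, ⟨γ, hγ⟩, ?_, ?_, hexact⟩, ?_, ?_⟩
  · ext b' c
    have := congrFun (hpair c) b'
    rw [Finset.sum_apply] at this
    rw [Matrix.sum_apply]
    exact this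
  · refine exists_sum_mul_transpose_eq_one fun ψ hψ => ?_
    have hli' := Fintype.linearIndependent_iff.1 (hli.comp _ e.symm.injective) ψ ?_
    · exact funext hli'
    · ext u
      have := congrFun (hψ u.1) u.2
      simpa [Finset.sum_apply, Matrix.vecMul, dotProduct, β] using this
  · intro ν hν
    let C : Matrix (Fin n × Fin x) (Fin y) k := Matrix.of fun u b => γ u.1 b u.2
    let νU : Fin n × Fin x → k := fun u => ν u.1 u.2
    have hAC : A * C = 1 := by
      rw [← hγ']
      ext b b'
      simp [A, C, Matrix.mul_apply, Matrix.sum_apply, Fintype.sum_prod_type]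
    have hvan : ∀ f ∈ Submodule.span k b, νU ⬝ᵥ f = 0 := by
      intro f hfK
      induction hfK using Submodule.span_induction with
      | mem f hfb =>
        have := congrFun hν (e ⟨f, hfb⟩)
        simpa [Finset.sum_apply, Matrix.mulVec, dotProduct, β, νU, Fintype.sum_prod_type,
          mul_comm] using this
      | zero => simp
      | add f g _ _ hf hg => rw [dotProduct_add, hf, hg, add_zero]
      | smul c f _ hf => rw [dotProduct_smul, hf, smul_zero]
    refine ⟨Matrix.vecMul νU C, fun i => ?_⟩
    ext a
    -- `C` is a right inverse of `A`, so `f - C A f` lies in the kernel for every `f`; a functional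
    -- vanishing on the kernel therefore factors through `A`.
    have h1 := hvan (Pi.single (i, a) 1 - C.mulVec (A.mulVec (Pi.single (i, a) 1))) (by
      rw [hspan]
      change A.mulVec _ = 0
      rw [Matrix.mulVec_sub, Matrix.mulVec_mulVec, hAC, Matrix.one_mulVec, sub_self])
    rw [dotProduct_sub, sub_eq_zero, Matrix.dotProduct_mulVec, Matrix.dotProduct_mulVec] at h1
    have h2 : νU (i, a) = Matrix.vecMul (Matrix.vecMul νU C) A (i, a) := by simpa using h1
    exact h2.symm
  · intro i c a hca
    exact hu₀ (e.symm c) (i, a) hca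
  · intro c
    rw [← hσ (u₀ (e.symm c)).2]
    exact even_length_stepWord _ _

end Matrices

/-! ### Tree modules -/

theorem CoverVertex.even_step {n : ℕ} (v : CoverVertex n) (i : Fin n) :
    Even (v.step i).word.length ↔ ¬ Even v.word.length :=
  even_length_stepWord i v.word

/-- The vertices of every second step of the walk from `v` with labels `p, q, p, q, …`. -/
def alternatingWalk {n : ℕ} (p q : Fin n) (v : CoverVertex n) : ℕ → CoverVertex n
  | 0 => v
  | i + 1 => ((alternatingWalk p q v i).step p).step q

section AlternatingWalk

variable {n : ℕ} {p q : Fin n} {v : CoverVertex n}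

theorem even_alternatingWalk (i : ℕ) :
    Even (alternatingWalk p q v i).word.length ↔ Even v.word.length := by
  induction i with
  | zero => rfl
  | succ i ih => simp [alternatingWalk, CoverVertex.even_step, ih]

theorem alternatingWalk_succ_step (i : ℕ) :
    (alternatingWalk p q v (i + 1)).step q = (alternatingWalk p q v i).step p :=
  CoverVertex.step_step _ _

theorem stepWord_eq_cons {l : Fin n} {w : List (Fin n)} (hw : ∀ j ∈ w.head?, j = q) (h : l ≠ q) :
    stepWord l w = l :: w := by
  cases w with
  | nil => rfl
  | cons j t =>
    have : j = q := hw j rfl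
    simp [stepWord, this, h]

/-- A word that is empty or ends in `q` admits the steps `p`, `q` without cancellation, so the walk
never turns back. -/
theorem head_alternatingWalk (hpq : p ≠ q) (hv : ∀ j ∈ v.word.head?, j = q) (i : ℕ) :
    (∀ j ∈ (alternatingWalk p q v i).word.head?, j = q) ∧
      (alternatingWalk p q v i).word.length = v.word.length + 2 * i := by
  induction i with
  | zero => exact ⟨hv, rfl⟩
  | succ i ih =>
    have : (alternatingWalk p q v (i + 1)).word = q :: p :: (alternatingWalk p q v i).word := by
      change stepWord q (stepWord p _) = _
      rw [stepWord_eq_cons ih.1 hpq]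
      simp [stepWord, hpq.symm]
    rw [this]
    constructor
    · simp
    · simp [ih.2]; ring

theorem alternatingWalk_step_word (hpq : p ≠ q) (hv : ∀ j ∈ v.word.head?, j = q) (i : ℕ)
    {l : Fin n} (hl : l ≠ q) :
    ((alternatingWalk p q v i).step l).word = l :: (alternatingWalk p q v i).word :=
  stepWord_eq_cons (head_alternatingWalk hpq hv i).1 hl

theorem alternatingWalk_injective (hpq : p ≠ q) (hv : ∀ j ∈ v.word.head?, j = q) :
    Function.Injective (alternatingWalk p q v) := by
  intro i j hij
  have hi := (head_alternatingWalk hpq hv i).2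
  have hj := (head_alternatingWalk hpq hv j).2
  rw [hij] at hi
  omega

/-- Each sink next to the spine is named by a pair `(m, j)` with `m ≠ q`. The only coincidence is
that the `q`-neighbour of a source is the `p`-neighbour of its predecessor on the spine. -/
theorem eq_of_alternatingWalk_step_eq (hpq : p ≠ q) (hv : v.word = [] ∨ v.word = [q])
    {i j : ℕ} {l m : Fin n} (hm : m ≠ q)
    (h : (alternatingWalk p q v j).step m = (alternatingWalk p q v i).step l) :
    l = m ∧ i = j ∨ l = q ∧ m = p ∧ i = j + 1 := by
  have hv' : ∀ j ∈ v.word.head?, j = q := by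
    rcases hv with h | h <;> simp [h]
  have h1 := congrArg CoverVertex.word h
  rw [alternatingWalk_step_word hpq hv' j hm] at h1
  by_cases hl : l = q
  · right
    subst hl
    cases i with
    | zero =>
      exfalso
      change _ = stepWord l v.word at h1
      rcases hv with h | h <;> simp [h, stepWord] at h1
      exact hm h1.1
    | succ i =>
      rw [alternatingWalk_succ_step, alternatingWalk_step_word hpq hv' i hpq] at h1
      obtain ⟨h2, h3⟩ := List.cons.inj h1
      exact ⟨rfl, h2, by rw [alternatingWalk_injective hpq hv' (CoverVertex.ext h3)]⟩
  · left
    rw [alternatingWalk_step_word hpq hv' i hl] at h1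
    obtain ⟨h2, h3⟩ := List.cons.inj h1
    exact ⟨h2.symm, (alternatingWalk_injective hpq hv' (CoverVertex.ext h3)).symm⟩

theorem exists_base_vertex (ε : Prop) (q : Fin n) :
    ∃ v : CoverVertex n, (v.word = [] ∨ v.word = [q]) ∧ (Even v.word.length ↔ ε) := by
  by_cases h : ε
  · exact ⟨⟨[], by simp⟩, Or.inl rfl, by simp [h]⟩
  · exact ⟨⟨[q], by simp⟩, Or.inr rfl, by simp [h]⟩

end AlternatingWalk

/-! ### Caterpillar modules -/

variable {k : Type u} [Field k] {n : ℕ}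

theorem MatrixIso.mulVec_injective_iff {x y : ℕ} {α β : Fin n → Matrix (Fin y) (Fin x) k}
    (h : MatrixIso α β) (i : Fin n) :
    Function.Injective (α i).mulVec ↔ Function.Injective (β i).mulVec := by
  obtain ⟨φ, ψ, hφ, hψ, hc⟩ := h
  have hφ' : Function.Bijective φ.mulVec :=
    ⟨Matrix.mulVec_injective_iff_isUnit.2 hφ, Matrix.mulVec_surjective_iff_isUnit.2 hφ⟩
  have hψ' : Function.Injective ψ.mulVec := Matrix.mulVec_injective_iff_isUnit.2 hψ
  have hcomp : ψ.mulVec ∘ (α i).mulVec = (β i).mulVec ∘ φ.mulVec := by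
    funext w
    simp [Matrix.mulVec_mulVec, hc]
  rw [← hψ'.of_comp_iff (α i).mulVec, hcomp]
  exact Function.Injective.of_comp_iff' _ hφ'

/-- The module of a caterpillar: its spine is an alternating walk with labels `p` and `q`, and the
sinks are the neighbours `(l, a)` of the sources `a` on the spine given by `δ`. -/
def caterpillar (k : Type u) [Field k] {x y : ℕ} (p q : Fin n) (δ : Fin y → Fin n × Fin x) :
    Fin n → Matrix (Fin y) (Fin x) k :=
  fun l => Matrix.of fun b a =>
    if l = (δ b).1 ∧ (a : ℕ) = (δ b).2 ∨ l = q ∧ (δ b).1 = p ∧ (a : ℕ) = (δ b).2 + 1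
      then 1 else 0

/-- A tree has no cycles: `f` is obtained by summing differences along the spine, and `g` is then
determined by the edge that names the sink. -/
theorem exists_potential {x y : ℕ} (p q : Fin n) (δ : Fin y → Fin n × Fin x)
    (hδ : Function.Injective δ) (β : Fin n → Matrix (Fin y) (Fin x) k) :
    ∃ (f : Fin x → k) (g : Fin y → k), (∀ b, β (δ b).1 b (δ b).2 = g b - f (δ b).2) ∧
      ∀ b (a : Fin x), (δ b).1 = p → (a : ℕ) = (δ b).2 + 1 → β q b a = g b - f a := by
  classical
  -- The increment of `f` from source `i` to source `i + 1`, read off the two edges at the sink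
  -- between them; zero where there is no such sink.
  let c : ℕ → k := fun i => if h : ∃ e : Fin y × Fin x, (δ e.1).1 = p ∧
    ((δ e.1).2 : ℕ) = i ∧ (e.2 : ℕ) = i + 1 then
      β p h.choose.1 (δ h.choose.1).2 - β q h.choose.1 h.choose.2 else 0
  let F : ℕ → k := fun i => ∑ j ∈ Finset.range i, c j
  refine ⟨fun a => F a, fun b => F (δ b).2 + β (δ b).1 b (δ b).2, fun b => by ring, ?_⟩
  intro b a hp ha
  have h : ∃ e : Fin y × Fin x, (δ e.1).1 = p ∧ ((δ e.1).2 : ℕ) = (δ b).2 ∧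
    (e.2 : ℕ) = (δ b).2 + 1 := ⟨(b, a), hp, rfl, ha⟩
  have he : h.choose = (b, a) := by
    obtain ⟨h1, h2, h3⟩ := h.choose_spec
    exact Prod.ext (hδ (Prod.ext (h1.trans hp.symm) (Fin.ext h2))) (Fin.ext (h3.trans ha.symm))
  have hc : c (δ b).2 = β p b (δ b).2 - β q b a := by
    simp only [c, dif_pos h, he]
  simp only [F, ha, Finset.sum_range_succ, hc, hp]
  ring

theorem isExceptionalGrading_caterpillar {ε : Prop} {x y : ℕ} {p q : Fin n} (hpq : p ≠ q)
    {δ : Fin y → Fin n × Fin x} (hδ : Function.Injective δ) (hq : ∀ b, (δ b).1 ≠ q)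
    (hx : 0 < x) (hp : ∀ a : Fin x, (a : ℕ) + 1 < x → ∃ b, δ b = (p, a))
    {v : CoverVertex n} (hv : v.word = [] ∨ v.word = [q]) (hε : Even v.word.length ↔ ε) :
    IsExceptionalGrading ε (caterpillar k p q δ) (fun a => alternatingWalk p q v a)
      (fun b => (alternatingWalk p q v (δ b).2).step (δ b).1) := by
  have hv' : ∀ j ∈ v.word.head?, j = q := by
    rcases hv with h | h <;> simp [h]
  have hadj : ∀ {l : Fin n} {b : Fin y} {a : Fin x},
      (alternatingWalk p q v (δ b).2).step (δ b).1 = (alternatingWalk p q v a).step l →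
      l = (δ b).1 ∧ (a : ℕ) = (δ b).2 ∨ l = q ∧ (δ b).1 = p ∧ (a : ℕ) = (δ b).2 + 1 :=
    fun h => eq_of_alternatingWalk_step_eq hpq hv (hq _) h
  -- The basis vectors have pairwise different degrees, so graded matrices are diagonal.
  have hφ : ∀ φ : Matrix (Fin x) (Fin x) k, IsGraded (fun a : Fin x => alternatingWalk p q v a)
      (fun a : Fin x => alternatingWalk p q v a) φ → φ = Matrix.diagonal fun a => φ a a := by
    intro φ h
    ext a a'
    by_cases haa : a = a'
    · simp [haa]
    · rw [Matrix.diagonal_apply_ne _ haa]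
      by_contra hne
      exact haa (Fin.ext (alternatingWalk_injective hpq hv' (h a a' hne)))
  have hψ : ∀ ψ : Matrix (Fin y) (Fin y) k,
      IsGraded (fun b => (alternatingWalk p q v (δ b).2).step (δ b).1)
        (fun b => (alternatingWalk p q v (δ b).2).step (δ b).1) ψ →
      ψ = Matrix.diagonal fun b => ψ b b := by
    intro ψ h
    ext b b'
    by_cases hbb : b = b'
    · simp [hbb]
    · rw [Matrix.diagonal_apply_ne _ hbb]
      by_contra hne
      rcases hadj (h b b' hne) with h1 | h1
      · exact hbb (hδ (Prod.ext h1.1.symm (Fin.ext h1.2.symm)))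
      · exact hq b' h1.1
  refine ⟨fun a => (even_alternatingWalk _).trans hε, fun b => ?_, ?_, ?_, ?_⟩
  · rw [CoverVertex.even_step, even_alternatingWalk, hε]
  · intro l b a h
    by_cases hc : l = (δ b).1 ∧ (a : ℕ) = (δ b).2 ∨
        l = q ∧ (δ b).1 = p ∧ (a : ℕ) = (δ b).2 + 1
    · rcases hc with ⟨rfl, h2⟩ | ⟨rfl, h2, h3⟩
      · simp only [h2]
      · simp only [h3, h2, alternatingWalk_succ_step]
    · simp [caterpillar, hc] at h
  · intro φ ψ h1 h2 hc
    rw [hφ φ h1, hψ ψ h2] at hc ⊢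
    have key : ∀ l b (a : Fin x), l = (δ b).1 ∧ (a : ℕ) = (δ b).2 ∨
        l = q ∧ (δ b).1 = p ∧ (a : ℕ) = (δ b).2 + 1 → ψ b b = φ a a := by
      intro l b a h
      have := congrFun (congrFun (hc l) b) a
      simpa [Matrix.diagonal_mul, Matrix.mul_diagonal, caterpillar, h] using this
    -- Consecutive sources share a sink by `hp`, so the scalar propagates along the spine.
    have hconst : ∀ i (hi : i < x), φ ⟨i, hi⟩ ⟨i, hi⟩ = φ ⟨0, hx⟩ ⟨0, hx⟩ := by
      intro i
      induction i with
      | zero => intro; rfl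
      | succ i ih =>
        intro hi
        obtain ⟨b, hb⟩ := hp ⟨i, by omega⟩ hi
        rw [← ih (by omega), ← key q b ⟨i + 1, hi⟩ (Or.inr ⟨rfl, by rw [hb], by rw [hb]⟩)]
        exact key p b _ (Or.inl ⟨by rw [hb], by rw [hb]⟩)
    refine ⟨φ ⟨0, hx⟩ ⟨0, hx⟩, ?_, ?_⟩
    · rw [← Matrix.diagonal_one, ← Matrix.diagonal_smul]
      congr 1
      ext a
      simp [hconst a a.2]
    · rw [← Matrix.diagonal_one, ← Matrix.diagonal_smul]
      congr 1
      ext b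
      simp [key _ b (δ b).2 (Or.inl ⟨rfl, rfl⟩), hconst _ (δ b).2.2]
  · intro β hβ
    obtain ⟨f, g, hfg1, hfg2⟩ := exists_potential p q δ hδ β
    refine ⟨Matrix.diagonal f, Matrix.diagonal g, ?_, ?_, fun l => ?_⟩
    · intro a a' h
      by_contra hne
      exact h (Matrix.diagonal_apply_ne _ fun e => hne (by rw [e]))
    · intro b b' h
      by_contra hne
      exact h (Matrix.diagonal_apply_ne _ fun e => hne (by rw [e]))
    · ext b a
      rw [Matrix.sub_apply, Matrix.diagonal_mul, Matrix.mul_diagonal]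
      by_cases hc : l = (δ b).1 ∧ (a : ℕ) = (δ b).2 ∨
          l = q ∧ (δ b).1 = p ∧ (a : ℕ) = (δ b).2 + 1
      · have : caterpillar k p q δ l b a = 1 := by simp [caterpillar, hc]
        rw [this, mul_one, one_mul]
        rcases hc with ⟨rfl, h2⟩ | ⟨rfl, h2, h3⟩
        · rw [Fin.ext h2, hfg1]
        · exact hfg2 b a h2 h3
      · have : caterpillar k p q δ l b a = 0 := by simp [caterpillar, hc]
        rw [this, mul_zero, zero_mul, sub_zero]
        by_contra hne
        exact hc (hadj (hβ l b a hne))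

/-- An isomorphism invariant that can be read off from `δ`. The label `q` never qualifies, since no
arrow labelled `q` starts at the first source of the spine. -/
theorem caterpillar_mulVec_injective_iff {x y : ℕ} {p q : Fin n}
    {δ : Fin y → Fin n × Fin x} (hq : ∀ b, (δ b).1 ≠ q) (hx : 0 < x) (l : Fin n) :
    Function.Injective (caterpillar k p q δ l).mulVec ↔ ∀ a, ∃ b, δ b = (l, a) := by
  have hcol : ∀ a, (∀ b, caterpillar k p q δ l b a = 0) →
      ¬ Function.Injective (caterpillar k p q δ l).mulVec := by
    intro a ha hinj
    have h1 : (caterpillar k p q δ l).mulVec (Pi.single a 1) =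
        (caterpillar k p q δ l).mulVec 0 := by
      ext b
      simp [ha]
    have h2 := congrFun (hinj h1) a
    simp at h2
  constructor
  · intro hinj a
    by_cases hl : l = q
    · exfalso
      refine hcol ⟨0, hx⟩ (fun b => ?_) hinj
      have : l ≠ (δ b).1 := fun e => hq b (e.symm.trans hl)
      simp [caterpillar, this]
    · by_contra hne
      push Not at hne
      refine hcol a (fun b => ?_) hinj
      have : ¬ (l = (δ b).1 ∧ (a : ℕ) = (δ b).2) := fun h =>
        hne b (Prod.ext h.1.symm (Fin.ext h.2.symm))
      simp [caterpillar, this, hl]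
  · intro h w w' hw
    ext a
    obtain ⟨b, hb⟩ := h a
    have hl : l ≠ q := fun e => hq b (by rw [hb, e])
    have := congrFun hw b
    simpa [Matrix.mulVec, dotProduct, caterpillar, hb, hl, Fin.val_inj] using this

/-! ### Families of exceptional gradings -/

/-- There are `n` pairwise non-isomorphic Kronecker modules of dimension vector `(x, y)` with
exceptional gradings of parity `ε`. -/
def HasExceptionalFamily (k : Type u) [Field k] (n : ℕ) (ε : Prop) (x y : ℕ) : Prop :=
  ∃ (α : Fin n → Fin n → Matrix (Fin y) (Fin x) k) (σ : Fin n → Fin x → CoverVertex n)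
    (τ : Fin n → Fin y → CoverVertex n), (∀ j, IsExceptionalGrading ε (α j) (σ j) (τ j)) ∧
    ∀ j j', MatrixIso (α j) (α j') → j = j'

theorem HasExceptionalFamily.swap {ε : Prop} {x y : ℕ}
    (h : HasExceptionalFamily k n (¬ ε) x y) : HasExceptionalFamily k n ε y x := by
  obtain ⟨α, σ, τ, h1, h2⟩ := h
  refine ⟨fun j i => (α j i).transpose, τ, σ, fun j => ?_, fun j j' hi => ?_⟩
  · simpa using (h1 j).transpose
  · exact (h2 j' j hi.transpose).symm

theorem HasExceptionalFamily.reflect {ε : Prop} {x y z : ℕ} (hx : 0 < x) (hz : y + z = n * x)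
    (h : HasExceptionalFamily k n ε x y) : HasExceptionalFamily k n ε x z := by
  obtain ⟨α, σ, τ, h1, h2⟩ := h
  have : Nonempty (Fin x) := ⟨⟨0, hx⟩⟩
  choose β ζ h3 h4 h5 using fun j => exists_isReflection (h1 j).even_source (h1 j).homogeneous
    (h1 j).exists_left_inverse hz
  exact ⟨β, σ, ζ, fun j => (h3 j).isExceptionalGrading (h1 j) (h4 j) (h5 j),
    fun j j' hi => (h2 j' j ((h3 j).matrixIso (h3 j') hi)).symm⟩

theorem hasExceptionalFamily_of_finsets {ε : Prop} {x y : ℕ} (hx : 0 < x) (p q : Fin n → Fin n)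
    (D : Fin n → Finset (Fin n × Fin x)) (hpq : ∀ j, p j ≠ q j) (hD : ∀ j, (D j).card = y)
    (hq : ∀ j, ∀ d ∈ D j, d.1 ≠ q j)
    (hp : ∀ j, ∀ a : Fin x, (a : ℕ) + 1 < x → (p j, a) ∈ D j)
    (hinj : ∀ j j', (∀ l, (∀ a, (l, a) ∈ D j) ↔ ∀ a, (l, a) ∈ D j') → j = j') :
    HasExceptionalFamily k n ε x y := by
  let δ : Fin n → Fin y → Fin n × Fin x := fun j b => ((D j).equivFinOfCardEq (hD j)).symm b
  have hδ : ∀ j d, (∃ b, δ j b = d) ↔ d ∈ D j := by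
    intro j d
    constructor
    · rintro ⟨b, rfl⟩
      exact (((D j).equivFinOfCardEq (hD j)).symm b).2
    · intro h
      exact ⟨(D j).equivFinOfCardEq (hD j) ⟨d, h⟩, by simp [δ]⟩
  have hδq : ∀ j b, (δ j b).1 ≠ q j := fun j b => hq j _ ((hδ j _).1 ⟨b, rfl⟩)
  choose v hv hε using fun j => exists_base_vertex ε (q j)
  refine ⟨fun j => caterpillar k (p j) (q j) (δ j), _, _, fun j =>
    isExceptionalGrading_caterpillar (hpq j) ?_ (hδq j) hx ?_ (hv j) (hε j), ?_⟩
  · exact Subtype.val_injective.comp (Equiv.injective _)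
  · exact fun a ha => (hδ j _).2 (hp j a ha)
  · intro j j' h
    refine hinj j j' fun l => ?_
    have := h.mulVec_injective_iff l
    rw [caterpillar_mulVec_injective_iff (hδq j) hx,
      caterpillar_mulVec_injective_iff (hδq j') hx] at this
    simpa only [hδ] using this

theorem le_choose {m : ℕ} : ∀ {n : ℕ}, 0 < m → m < n → n ≤ n.choose m := by
  intro n hm
  induction n generalizing m with
  | zero => omega
  | succ n ih =>
    intro h
    obtain ⟨m, rfl⟩ : ∃ l, m = l + 1 := ⟨m - 1, by omega⟩
    rcases Nat.eq_zero_or_pos m with rfl | hm'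
    · simp
    · rw [Nat.choose_succ_succ']
      have := ih hm' (by omega)
      have := Nat.choose_pos (n := n) (k := m + 1) (by omega)
      omega

theorem hasExceptionalFamily_one {ε : Prop} {y : ℕ} (hy : 0 < y) (hyn : y < n) :
    HasExceptionalFamily k n ε 1 y := by
  have hcard : Fintype.card (Fin n) ≤
      Fintype.card (Finset.powersetCard y (Finset.univ : Finset (Fin n))) := by
    -- For `x = 1` the modules are stars given by `y`-element sets of labels; there are at least `n`
    -- of these because `0 < y < n`.
    simpa using le_choose hy hyn
  obtain ⟨s⟩ := Function.Embedding.nonempty_of_card_le hcard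
  have hs : ∀ j, (s j).1.card = y := fun j => (Finset.mem_powersetCard.1 (s j).2).2
  have hq : ∀ j, ∃ q, q ∉ (s j).1 := by
    intro j
    by_contra! h
    have := Finset.card_le_card (fun q _ => h q : Finset.univ ⊆ (s j).1)
    simp [hs] at this
    omega
  choose q hq using hq
  have : Nontrivial (Fin n) := Fin.nontrivial_iff_two_le.2 (by omega)
  choose p hp using fun j => exists_ne (q j)
  refine hasExceptionalFamily_of_finsets one_pos p q
    (fun j => (s j).1 ×ˢ Finset.univ) hp (fun j => by simp [hs]) ?_ (fun j a ha => by omega) ?_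
  · intro j d hd e
    exact hq j (e ▸ (Finset.mem_product.1 hd).1)
  · intro j j' h
    apply s.injective
    apply Subtype.ext
    ext l
    simpa using h l

theorem hasExceptionalFamily_of_two_le {ε : Prop} {x y : ℕ} (hx : 2 ≤ x) (hn : 2 ≤ n)
    (hxy : x ≤ y) (hy : 2 * y ≤ n * x) : HasExceptionalFamily k n ε x y := by
  have : Nontrivial (Fin n) := Fin.nontrivial_iff_two_le.2 hn
  choose q hq using fun j : Fin n => exists_ne j
  -- The `y - x` leaves beyond the full set with label `j` avoid the labels `j`, `q j` and the last
  -- source, so that `j` stays the only label present at every source. There is room: `y - x ≤ (n -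
  -- 2) x / 2 ≤ (n - 2) (x - 1)`, using `2 ≤ x`.
  have hD : ∀ j, ∃ D : Finset (Fin n × Fin x), D ⊆ ({j, q j} : Finset (Fin n))ᶜ ×ˢ
      Finset.univ.filter (fun a : Fin x => (a : ℕ) + 1 < x) ∧ D.card = y - x := by
    intro j
    apply Finset.exists_subset_card_eq
    have h1 : (Finset.univ.filter (fun a : Fin x => (a : ℕ) + 1 < x)).card = x - 1 := by
      obtain ⟨m, rfl⟩ : ∃ m, x = m + 1 := ⟨x - 1, by omega⟩
      have : (Finset.univ.filter fun a : Fin (m + 1) => (a : ℕ) + 1 < m + 1) =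
          Finset.Iio (Fin.last m) := by
        ext a
        simp only [Finset.mem_filter, Finset.mem_univ, true_and, Finset.mem_Iio, Fin.lt_def,
          Fin.val_last]
        omega
      rw [this]
      simp
    rw [Finset.card_product, Finset.card_compl, Finset.card_pair (hq j).symm, h1,
      Fintype.card_fin]
    obtain ⟨m, rfl⟩ : ∃ m, n = m + 2 := ⟨n - 2, by omega⟩
    obtain ⟨w, rfl⟩ : ∃ w, x = w + 2 := ⟨x - 2, by omega⟩
    have : y - (w + 2) ≤ m * (w + 1) := by
      have h3 : 0 ≤ m * w := Nat.zero_le _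
      have : 2 * y ≤ m * w + 2 * m + 2 * w + 4 := by nlinarith
      have : m * (w + 1) = m * w + m := by ring
      omega
    simpa using this
  choose D hD hcard using hD
  refine hasExceptionalFamily_of_finsets (by omega) id q
    (fun j => {j} ×ˢ Finset.univ ∪ D j) (fun j => (hq j).symm) (fun j => ?_) ?_
    (fun j a _ => by simp) ?_
  · rw [Finset.card_union_of_disjoint, hcard]
    · simp; omega
    · rw [Finset.disjoint_left]
      intro d h1 h2
      have h3 := (Finset.mem_product.1 (hD j h2)).1
      have h4 := (Finset.mem_product.1 h1).1
      simp only [Finset.mem_singleton] at h4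
      simp [h4] at h3
  · intro j d hd
    rcases Finset.mem_union.1 hd with h | h
    · have h4 := (Finset.mem_product.1 h).1
      simp only [Finset.mem_singleton] at h4
      rw [h4]
      exact (hq j).symm
    · have h3 := (Finset.mem_product.1 (hD j h)).1
      simp only [Finset.mem_compl, Finset.mem_insert, Finset.mem_singleton, not_or] at h3
      exact h3.2
  · have key : ∀ j l, (∀ a, (l, a) ∈ {j} ×ˢ Finset.univ ∪ D j) ↔ l = j := by
      intro j l
      constructor
      · intro h
        rcases Finset.mem_union.1 (h ⟨x - 1, by omega⟩) with h | h
        · simpa [eq_comm] using h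
        · have h3 := (Finset.mem_product.1 (hD j h)).2
          simp only [Finset.mem_filter] at h3
          omega
      · rintro rfl a
        simp
    intro j j' h
    simp only [key] at h
    exact (h j).1 rfl

theorem hasExceptionalFamily_of_le {ε : Prop} {x y : ℕ} (hx : 0 < x) (hn : 2 ≤ n)
    (hxy : x ≤ y) (hy : 2 * y ≤ n * x) : HasExceptionalFamily k n ε x y := by
  obtain rfl | h : x = 1 ∨ 2 ≤ x := by omega
  · exact hasExceptionalFamily_one (by omega) (by omega)
  · exact hasExceptionalFamily_of_two_le h hn hxy hy

theorem hasExceptionalFamily {x y : ℕ} (hx : 0 < x) (hy : 0 < y)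
    (hxy : x ^ 2 + y ^ 2 ≤ n * x * y) (ε : Prop) : HasExceptionalFamily k n ε x y := by
  induction hs : x + y using Nat.strong_induction_on generalizing x y ε with
  | _ s ih =>
    have key : ∀ {x y : ℕ}, 0 < x → 0 < y → x ^ 2 + y ^ 2 ≤ n * x * y → x + y = s →
        n * x < 2 * y → ∀ ε, HasExceptionalFamily k n ε x y := by
      intro x y hx hy hxy hs h ε
      have hle : y < n * x := by
        by_contra! h'
        nlinarith [Nat.mul_le_mul_right y h', Nat.pow_pos (n := 2) hx]
      obtain ⟨z, hz⟩ := Nat.exists_eq_add_of_lt hle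
      -- Here `z + 1 = n x - y`, which is positive by `hle` and less than `y` by `h`.
      refine HasExceptionalFamily.reflect (y := z + 1) hx (by omega)
        (ih (x + (z + 1)) (by omega) hx (by omega) ?_ ε rfl)
      have hz' : (n : ℤ) * x = y + z + 1 := by exact_mod_cast hz
      zify at hxy ⊢
      rw [hz'] at hxy ⊢
      nlinarith
    by_cases h1 : n * x < 2 * y
    · exact key hx hy hxy hs h1 ε
    by_cases h2 : n * y < 2 * x
    -- Transposition flips the parity, which is why the induction runs over all `ε`.
    · exact (key hy hx (by rw [add_comm]; convert! hxy using 1; ring) (by omega) h2 _).swap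
    push Not at h1 h2
    have hn : 2 ≤ n := by
      by_contra! hn
      have h3 : n * x ≤ 1 * x := Nat.mul_le_mul_right x (by omega)
      have h4 : n * y ≤ 1 * y := Nat.mul_le_mul_right y (by omega)
      omega
    rcases le_total x y with h | h
    · exact hasExceptionalFamily_of_le hx hn h h1
    · exact (hasExceptionalFamily_of_le hy hn h h2).swap

/-! ### Extensions and endomorphisms of quiver representations -/

section QuiverRepresentations

variable {k : Type u} [Field k] {V : Type} [Quiver.{0} V]

/-- A morphism of representations from linear maps that commute with the arrows. -/
def homOfArrows {M N : QuiverRep k V} (f : ∀ a, space M a →ₗ[k] space N a)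
    (hf : ∀ (a b : V) (e : a ⟶ b), f b ∘ₗ arrowMap M e = arrowMap N e ∘ₗ f a) : M ⟶ N where
  app a := ModuleCat.ofHom (f a)
  naturality a b p := by
    let F : ∀ a : Paths V, M.obj a ⟶ N.obj a := fun a => ModuleCat.ofHom (f a)
    refine Paths.induction (fun {a b} p => M.map p ≫ F b = F a ≫ N.map p) ?_ ?_ p
    · intro v
      rw [M.map_id, N.map_id, Category.id_comp, Category.comp_id]
    · intro u v w p e ih
      have he : M.map ((Paths.of V).map e) ≫ F ((Paths.of V).obj w) =
          F ((Paths.of V).obj v) ≫ N.map ((Paths.of V).map e) := by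
        ext1
        exact hf v w e
      rw [M.map_comp, N.map_comp, Category.assoc, he, reassoc_of% ih]

/-- Choose linear sections `s a` vertexwise. Their failure to commute with the arrows takes values
in the subobject, hence is a cocycle; writing it as the coboundary of `θ` makes `s a - f a ∘ₗ θ a` a
section of representations. -/
theorem hasNoSelfExtension_of_cocycles {M : QuiverRep k V}
    (h : ∀ γ : ∀ a b : V, (a ⟶ b) → (space M a →ₗ[k] space M b),
      ∃ θ : ∀ a, space M a →ₗ[k] space M a, ∀ a b e,
        γ a b e = arrowMap M e ∘ₗ θ a - θ b ∘ₗ arrowMap M e) :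
    HasNoSelfExtension M := by
  rintro S hS ⟨i₁⟩ ⟨i₃⟩
  have hev : ∀ a : V, (S.map ((evaluation (Paths V) (ModuleCat.{u} k)).obj
      ((Paths.of V).obj a))).ShortExact := fun a => hS.map_of_exact _
  let f : ∀ a, space M a →ₗ[k] space S.X₂ a := fun a => ((i₁.inv ≫ S.f).app _).hom
  let g : ∀ a, space S.X₂ a →ₗ[k] space M a := fun a => ((S.g ≫ i₃.hom).app _).hom
  have hf : ∀ a b (e : a ⟶ b), f b ∘ₗ arrowMap M e = arrowMap S.X₂ e ∘ₗ f a := fun a b e =>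
    congrArg ModuleCat.Hom.hom ((i₁.inv ≫ S.f).naturality ((Paths.of V).map e))
  have hg : ∀ a b (e : a ⟶ b), g b ∘ₗ arrowMap S.X₂ e = arrowMap M e ∘ₗ g a := fun a b e =>
    congrArg ModuleCat.Hom.hom ((S.g ≫ i₃.hom).naturality ((Paths.of V).map e))
  have hfi : ∀ a, Function.Injective (f a) := fun a => by
    have h1 := (hev a).moduleCat_injective_f
    have h2 : Function.Injective (i₁.inv.app ((Paths.of V).obj a)).hom :=
      ((i₁.symm.app _).toLinearEquiv).injective
    exact h1.comp h2
  have hgs : ∀ a, Function.Surjective (g a) := fun a => by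
    have h1 := (hev a).moduleCat_surjective_g
    have h2 : Function.Surjective (i₃.hom.app ((Paths.of V).obj a)).hom :=
      ((i₃.app _).toLinearEquiv).surjective
    exact h2.comp h1
  have hfg : ∀ a z, g a z = 0 → ∃ w, f a w = z := fun a z hz => by
    have h1 := (ShortComplex.ShortExact.moduleCat_exact_iff_function_exact _).1 (hev a).exact
    have h2 : Function.Injective (i₃.hom.app ((Paths.of V).obj a)).hom :=
      ((i₃.app _).toLinearEquiv).injective
    have h3 : Function.Surjective (i₁.inv.app ((Paths.of V).obj a)).hom :=
      ((i₁.symm.app _).toLinearEquiv).surjective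
    obtain ⟨w, hw⟩ := (h1 z).1 (h2 (hz.trans (map_zero _).symm))
    obtain ⟨w', rfl⟩ := h3 w
    exact ⟨w', hw⟩
  have hgf : ∀ a, g a ∘ₗ f a = 0 := fun a => by
    have : (i₁.inv ≫ S.f) ≫ (S.g ≫ i₃.hom) = 0 := by simp
    exact congrArg (fun t => ModuleCat.Hom.hom (NatTrans.app t ((Paths.of V).obj a))) this
  choose s hs using fun a => (g a).exists_rightInverse_of_surjective
    (LinearMap.range_eq_top.2 (hgs a))
  choose r hr using fun a => (f a).exists_leftInverse_of_injective (LinearMap.ker_eq_bot.2 (hfi a))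
  obtain ⟨θ, hθ⟩ := h fun a b e => r b ∘ₗ (arrowMap S.X₂ e ∘ₗ s a - s b ∘ₗ arrowMap M e)
  have hsplit : ∀ a b (e : a ⟶ b), arrowMap S.X₂ e ∘ₗ s a - s b ∘ₗ arrowMap M e =
      f b ∘ₗ (arrowMap M e ∘ₗ θ a - θ b ∘ₗ arrowMap M e) := by
    intro a b e
    rw [← hθ]
    ext v
    obtain ⟨w, hw⟩ := hfg b ((arrowMap S.X₂ e ∘ₗ s a - s b ∘ₗ arrowMap M e) v) (by
      have h1 := LinearMap.congr_fun (hg a b e) (s a v)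
      have h2 := LinearMap.congr_fun (hs a) v
      have h3 := LinearMap.congr_fun (hs b) (arrowMap M e v)
      simp only [LinearMap.comp_apply, LinearMap.id_apply] at h1 h2 h3
      rw [LinearMap.sub_apply, LinearMap.comp_apply, LinearMap.comp_apply, map_sub, h1, h2, h3,
        sub_self])
    rw [LinearMap.comp_apply, LinearMap.comp_apply, ← hw]
    exact congrArg (f b) (LinearMap.congr_fun (hr b) w).symm
  let t : M ⟶ S.X₂ := homOfArrows (fun a => s a - f a ∘ₗ θ a) fun a b e => by
    have h1 := hsplit a b e
    have h2 := hf a b e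
    rw [LinearMap.sub_comp, LinearMap.comp_sub, LinearMap.comp_assoc, ← LinearMap.comp_assoc (θ a),
      ← h2]
    rw [LinearMap.comp_sub, sub_eq_sub_iff_add_eq_add] at h1
    rw [sub_eq_sub_iff_add_eq_add, LinearMap.comp_assoc]
    rw [add_comm, ← h1, add_comm]
  have ht : t ≫ S.g ≫ i₃.hom = 𝟙 M := by
    have key : ∀ a, g a ∘ₗ (s a - f a ∘ₗ θ a) = LinearMap.id := fun a => by
      rw [LinearMap.comp_sub, hs, ← LinearMap.comp_assoc, hgf, LinearMap.zero_comp, sub_zero]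
    ext a : 2
    ext1
    exact key a
  exact ⟨ShortComplex.Splitting.ofExactOfSection S hS.exact (i₃.hom ≫ t) (by
    rw [← cancel_mono i₃.hom, Category.assoc, Category.assoc, ht]; simp) hS.mono_f⟩

theorem indecomposable_of_idempotents {C : Type*} [Category* C] [Preadditive C]
    [HasBinaryBiproducts C] {M : C} (h0 : ¬ IsZero M)
    (h : ∀ P : M ⟶ M, P ≫ P = P → P = 0 ∨ P = 𝟙 M) : Indecomposable M := by
  refine ⟨h0, fun Y Z e => ?_⟩
  rcases h (e.hom ≫ biprod.fst ≫ biprod.inl ≫ e.inv) (by simp) with h1 | h1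
  · left
    rw [IsZero.iff_id_eq_zero]
    have : (biprod.inl : Y ⟶ Y ⊞ Z) ≫ e.inv ≫ (e.hom ≫ biprod.fst ≫ biprod.inl ≫ e.inv) ≫ e.hom ≫
        biprod.fst = 𝟙 Y := by simp
    rw [← this, h1]
    simp
  · right
    rw [IsZero.iff_id_eq_zero]
    have : (biprod.inr : Z ⟶ Y ⊞ Z) ≫ e.inv ≫ (e.hom ≫ biprod.fst ≫ biprod.inl ≫ e.inv) ≫ e.hom ≫
        biprod.snd = 0 := by simp
    rw [← this, h1]
    simp

end QuiverRepresentations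

/-! ### The representation of the covering given by a graded module -/

section GradedRepresentation

variable {k : Type u} [Field k] {n x y : ℕ}

/-- The label of an arrow of the covering. -/
def arrowLabel {a b : CoverVertex n} : (a ⟶ b) → Fin n
  | .lift _ i => i

/-- The basis vectors of a given degree. -/
abbrev Fibre (σ : Fin x → CoverVertex n) (τ : Fin y → CoverVertex n) (g : CoverVertex n) : Type :=
  {z : Fin x ⊕ Fin y // Sum.elim σ τ z = g}

/-- The representation of the covering given by a graded module. -/
def gradedRep (α : Fin n → Matrix (Fin y) (Fin x) k) (σ : Fin x → CoverVertex n)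
    (τ : Fin y → CoverVertex n) : QuiverRep k (CoverVertex n) :=
  Paths.lift
    { obj := fun g => ModuleCat.of k (Fibre σ τ g → k)
      map := fun e => ModuleCat.ofHom
        ((Matrix.fromBlocks 0 0 (α (arrowLabel e)) 0).submatrix Subtype.val
          Subtype.val).mulVecLin }

variable {α : Fin n → Matrix (Fin y) (Fin x) k} {σ : Fin x → CoverVertex n}
  {τ : Fin y → CoverVertex n}

theorem arrowMap_gradedRep {a b : CoverVertex n} (e : a ⟶ b) :
    arrowMap (gradedRep α σ τ) e =
      ((Matrix.fromBlocks 0 0 (α (arrowLabel e)) 0).submatrix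
        (Subtype.val : Fibre σ τ b → _) (Subtype.val : Fibre σ τ a → _)).mulVecLin :=
  congrArg ModuleCat.Hom.hom (Paths.lift_toPath _ e)

theorem isFiniteDimensional_gradedRep : IsFiniteDimensional (gradedRep α σ τ) := by
  refine ⟨fun a => inferInstanceAs (FiniteDimensional k (Fibre σ τ a → k)), ?_⟩
  refine (Set.finite_range (Sum.elim σ τ)).subset fun g hg => ?_
  by_contra hne
  have : IsEmpty (Fibre σ τ g) := ⟨fun z => hne ⟨z.1, z.2⟩⟩
  have h1 : Nontrivial (Fibre σ τ g → k) := hg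
  exact not_subsingleton _ (inferInstance : Subsingleton (Fibre σ τ g → k))

/-- This makes products of blocks between fibres equal to blocks of products on `Fin x ⊕ Fin y`, so
vertexwise identities reduce to identities of total matrices. -/
theorem sum_fibre {R : Type*} [AddCommMonoid R] {g : CoverVertex n} {F : Fin x ⊕ Fin y → R}
    (hF : ∀ z, F z ≠ 0 → Sum.elim σ τ z = g) : ∑ z : Fibre σ τ g, F z.1 = ∑ z, F z := by
  classical
  rw [← Finset.sum_subtype (Finset.univ.filter fun z => Sum.elim σ τ z = g) (by simp) F,
    Finset.sum_filter_of_ne fun z _ hz => hF z hz]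

/-- The matrix of a family of endomorphisms of the spaces of a graded module. -/
def totalMatrix (θ : ∀ g, (Fibre σ τ g → k) →ₗ[k] (Fibre σ τ g → k)) :
    Matrix (Fin x ⊕ Fin y) (Fin x ⊕ Fin y) k :=
  Matrix.of fun w z => if h : Sum.elim σ τ w = Sum.elim σ τ z then
    θ (Sum.elim σ τ z) (Pi.single ⟨z, rfl⟩ 1) ⟨w, h⟩ else 0

theorem isGraded_totalMatrix (θ : ∀ g, (Fibre σ τ g → k) →ₗ[k] (Fibre σ τ g → k)) :
    IsGraded (Sum.elim σ τ) (Sum.elim σ τ) (totalMatrix θ) := by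
  intro w z h
  by_contra hne
  simp [totalMatrix, hne] at h

theorem totalMatrix_submatrix (θ : ∀ g, (Fibre σ τ g → k) →ₗ[k] (Fibre σ τ g → k))
    (g : CoverVertex n) : θ g = ((totalMatrix θ).submatrix
      (Subtype.val : Fibre σ τ g → _) (Subtype.val : Fibre σ τ g → _)).mulVecLin := by
  refine (Pi.basisFun k _).ext fun z => ?_
  ext w
  obtain ⟨z, rfl⟩ := z
  have : totalMatrix θ w.1 z = _ := dif_pos w.2
  simp [this]

theorem submatrix_mul_of_right_graded {Φ : Matrix (Fin x ⊕ Fin y) (Fin x ⊕ Fin y) k}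
    (hΦ : IsGraded (Sum.elim σ τ) (Sum.elim σ τ) Φ)
    (T : Matrix (Fin x ⊕ Fin y) (Fin x ⊕ Fin y) k) (a b : CoverVertex n) :
    T.submatrix (Subtype.val : Fibre σ τ b → _) (Subtype.val : Fibre σ τ a → _) *
      Φ.submatrix (Subtype.val : Fibre σ τ a → _) (Subtype.val : Fibre σ τ a → _) =
    (T * Φ).submatrix Subtype.val Subtype.val := by
  ext w z
  exact sum_fibre (F := fun u => T w.1 u * Φ u z.1) fun u hu =>
    (hΦ _ _ (right_ne_zero_of_mul hu)).trans z.2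

theorem submatrix_mul_of_left_graded {Φ : Matrix (Fin x ⊕ Fin y) (Fin x ⊕ Fin y) k}
    (hΦ : IsGraded (Sum.elim σ τ) (Sum.elim σ τ) Φ)
    (T : Matrix (Fin x ⊕ Fin y) (Fin x ⊕ Fin y) k) (a b : CoverVertex n) :
    Φ.submatrix (Subtype.val : Fibre σ τ b → _) (Subtype.val : Fibre σ τ b → _) *
      T.submatrix (Subtype.val : Fibre σ τ b → _) (Subtype.val : Fibre σ τ a → _) =
    (Φ * T).submatrix Subtype.val Subtype.val := by
  ext w z
  exact sum_fibre (F := fun u => Φ w.1 u * T u z.1) fun u hu =>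
    (hΦ _ _ (left_ne_zero_of_mul hu)).symm.trans w.2

theorem IsExceptionalGrading.fromBlocks_of_isGraded {ε : Prop}
    (h : IsExceptionalGrading ε α σ τ) {Φ : Matrix (Fin x ⊕ Fin y) (Fin x ⊕ Fin y) k}
    (hΦ : IsGraded (Sum.elim σ τ) (Sum.elim σ τ) Φ) :
    Φ = Matrix.fromBlocks Φ.toBlocks₁₁ 0 0 Φ.toBlocks₂₂ := by
  have hne : ∀ a b, σ a ≠ τ b := fun a b e => by
    have h1 := h.even_source a
    rw [e, h.even_sink b] at h1
    tauto
  ext (a | b) (a' | b')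
  · rfl
  · exact not_not.1 (mt (hΦ _ _) (hne a b'))
  · exact not_not.1 (mt (hΦ _ _) (hne a' b).symm)
  · rfl

theorem IsExceptionalGrading.exists_eq_smul_id (h : IsExceptionalGrading True α σ τ)
    (f : gradedRep α σ τ ⟶ gradedRep α σ τ) :
    ∃ c : k, ∀ g : CoverVertex n, (f.app ((Paths.of _).obj g)).hom =
      c • (LinearMap.id : space (gradedRep α σ τ) g →ₗ[k] space (gradedRep α σ τ) g) := by
  let θ : ∀ g, (Fibre σ τ g → k) →ₗ[k] (Fibre σ τ g → k) := fun g =>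
    (f.app ((Paths.of _).obj g)).hom
  have hΦ := isGraded_totalMatrix θ
  let T : Fin n → Matrix (Fin x ⊕ Fin y) (Fin x ⊕ Fin y) k :=
    fun i => Matrix.fromBlocks 0 0 (α i) 0
  have hT : ∀ i w z, T i w z ≠ 0 →
      ∃ a b, z = Sum.inl a ∧ w = Sum.inr b ∧ τ b = (σ a).step i := by
    intro i w z hwz
    rcases w with a' | b <;> rcases z with a | b' <;> try exact (hwz rfl).elim
    exact ⟨a, b, rfl, rfl, h.homogeneous i b a hwz⟩
  have hnat : ∀ (v : CoverSource n) (i : Fin n),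
      (totalMatrix θ * T i).submatrix (Subtype.val : Fibre σ τ (v.step i).1 → _)
        (Subtype.val : Fibre σ τ v.1 → _) =
      (T i * totalMatrix θ).submatrix Subtype.val Subtype.val := by
    intro v i
    have h1 : θ (v.step i).1 ∘ₗ arrowMap (gradedRep α σ τ) (liftArrow v i) =
        arrowMap (gradedRep α σ τ) (liftArrow v i) ∘ₗ θ v.1 :=
      congrArg ModuleCat.Hom.hom (f.naturality ((Paths.of _).map (liftArrow v i)))
    rw [arrowMap_gradedRep] at h1
    have h2 : θ (v.step i).1 ∘ₗ ((T i).submatrix (Subtype.val : Fibre σ τ (v.step i).1 → _)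
        (Subtype.val : Fibre σ τ v.1 → _)).mulVecLin =
      ((T i).submatrix (Subtype.val : Fibre σ τ (v.step i).1 → _)
        (Subtype.val : Fibre σ τ v.1 → _)).mulVecLin ∘ₗ θ v.1 := h1
    rw [totalMatrix_submatrix θ (v.step i).1, totalMatrix_submatrix θ v.1,
      ← Matrix.mulVecLin_mul, ← Matrix.mulVecLin_mul,
      submatrix_mul_of_left_graded hΦ, submatrix_mul_of_right_graded hΦ] at h2
    exact Matrix.toLin'.injective h2
  -- Naturality gives the entries lying over an arrow labelled `i`; all other entries vanish on both
  -- sides by homogeneity.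
  have hcomm : ∀ i, totalMatrix θ * T i = T i * totalMatrix θ := by
    intro i
    ext w z
    by_cases hwz : Even (Sum.elim σ τ z).word.length ∧
        Sum.elim σ τ w = (Sum.elim σ τ z).step i
    · exact congrFun (congrFun (hnat ⟨Sum.elim σ τ z, hwz.1⟩ i) ⟨w, hwz.2⟩) ⟨z, rfl⟩
    · have h1 : (totalMatrix θ * T i) w z = 0 := by
        rw [Matrix.mul_apply]
        refine Finset.sum_eq_zero fun u _ => ?_
        by_contra hne
        obtain ⟨a, b, rfl, rfl, hab⟩ := hT i u z (right_ne_zero_of_mul hne)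
        exact hwz ⟨(h.even_source a).2 trivial, (hΦ _ _ (left_ne_zero_of_mul hne)).trans hab⟩
      have h2 : (T i * totalMatrix θ) w z = 0 := by
        rw [Matrix.mul_apply]
        refine Finset.sum_eq_zero fun u _ => ?_
        by_contra hne
        obtain ⟨a, b, rfl, rfl, hab⟩ := hT i w u (left_ne_zero_of_mul hne)
        have h3 : σ a = Sum.elim σ τ z := hΦ _ _ (right_ne_zero_of_mul hne)
        rw [← h3] at hwz
        exact hwz ⟨(h.even_source a).2 trivial, hab⟩
      rw [h1, h2]
  have hblock := h.fromBlocks_of_isGraded hΦ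
  obtain ⟨c, h1, h2⟩ := h.brick (totalMatrix θ).toBlocks₁₁ (totalMatrix θ).toBlocks₂₂
    (fun a a' haa => hΦ (Sum.inl a) (Sum.inl a') haa)
    (fun b b' hbb => hΦ (Sum.inr b) (Sum.inr b') hbb) fun i => by
      have := hcomm i
      rw [hblock] at this
      simp only [T, Matrix.fromBlocks_multiply] at this
      simpa using (Matrix.fromBlocks_inj.1 this).2.2.1
  have hc : totalMatrix θ = c • 1 := by
    rw [hblock, h1, h2, ← Matrix.fromBlocks_one, Matrix.fromBlocks_smul]
    simp
  refine ⟨c, fun g => ?_⟩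
  have h3 : θ g = c • LinearMap.id := by
    rw [totalMatrix_submatrix θ g, hc]
    refine (Pi.basisFun k _).ext fun z => ?_
    ext w
    simp [Matrix.one_apply, Pi.single_apply, Subtype.val_inj]
  exact h3

theorem IsExceptionalGrading.indecomposable (hx : 0 < x) (h : IsExceptionalGrading True α σ τ) :
    Indecomposable (gradedRep α σ τ) := by
  let a₀ : Fin x := ⟨0, hx⟩
  let z₀ : Fibre σ τ (σ a₀) := ⟨Sum.inl a₀, rfl⟩
  have hzero : (Pi.single z₀ 1 : Fibre σ τ (σ a₀) → k) ≠ 0 := by simp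
  apply indecomposable_of_idempotents
  · intro h0
    have h1 : 𝟙 (gradedRep α σ τ) = 0 := h0.eq_of_src _ _
    have h2 := congrArg (fun t : gradedRep α σ τ ⟶ gradedRep α σ τ =>
        (t.app ((Paths.of _).obj (σ a₀))).hom
      (Pi.single z₀ 1 : Fibre σ τ (σ a₀) → k)) h1
    exact hzero h2
  · intro P hP
    obtain ⟨c, hc⟩ := h.exists_eq_smul_id P
    have h2 : (P.app ((Paths.of _).obj (σ a₀))).hom ∘ₗ (P.app ((Paths.of _).obj (σ a₀))).hom =
        (P.app ((Paths.of _).obj (σ a₀))).hom :=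
      congrArg (fun t : gradedRep α σ τ ⟶ gradedRep α σ τ =>
        (t.app ((Paths.of _).obj (σ a₀))).hom) hP
    rw [hc] at h2
    have h3 := LinearMap.congr_fun h2 (Pi.single z₀ 1 : Fibre σ τ (σ a₀) → k)
    have h4 : c • c • (Pi.single z₀ 1 : Fibre σ τ (σ a₀) → k) = c • Pi.single z₀ 1 := h3
    rw [smul_smul] at h4
    have h5 : c * c = c := smul_left_injective k hzero h4
    rcases eq_or_ne c 0 with rfl | hc0
    · left
      ext a : 2
      ext1
      exact (hc a).trans (zero_smul _ _)
    · right
      have : c = 1 := mul_left_cancel₀ hc0 (by rw [h5, mul_one])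
      subst this
      ext a : 2
      ext1
      exact (hc a).trans (one_smul _ _)

theorem IsExceptionalGrading.hasNoSelfExtension (h : IsExceptionalGrading True α σ τ) :
    HasNoSelfExtension (gradedRep α σ τ) := by
  apply hasNoSelfExtension_of_cocycles
  intro γ
  let γ' : ∀ a b : CoverVertex n, (a ⟶ b) → (Fibre σ τ a → k) →ₗ[k] (Fibre σ τ b → k) := γ
  let β : Fin n → Matrix (Fin y) (Fin x) k := fun i => Matrix.of fun b a =>
    if hb : τ b = (σ a).step i then
      γ' _ _ (liftArrow ⟨σ a, (h.even_source a).2 trivial⟩ i) (Pi.single ⟨Sum.inl a, rfl⟩ 1)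
        ⟨Sum.inr b, hb⟩ else 0
  have hβ : IsHomogeneous σ τ β := by
    intro i b a hne
    by_contra hab
    simp [β, hab] at hne
  obtain ⟨φ, ψ, hφ, hψ, hc⟩ := h.rigid β hβ
  let Φ := Matrix.fromBlocks φ 0 0 ψ
  have hΦ : IsGraded (Sum.elim σ τ) (Sum.elim σ τ) Φ := by
    rintro (a | b) (a' | b') hne
    · exact hφ a a' hne
    · exact (hne rfl).elim
    · exact (hne rfl).elim
    · exact hψ b b' hne
  -- The sign reconciles `ψ * α i - α i * φ` with the opposite order in the coboundaries of
  -- `hasNoSelfExtension_of_cocycles`.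
  let θ : ∀ g, (Fibre σ τ g → k) →ₗ[k] (Fibre σ τ g → k) := fun g =>
    (-(Φ.submatrix Subtype.val Subtype.val)).mulVecLin
  refine ⟨θ, fun a b e => ?_⟩
  rw [arrowMap_gradedRep]
  obtain ⟨v, i⟩ := e
  let T : Matrix (Fin x ⊕ Fin y) (Fin x ⊕ Fin y) k := Matrix.fromBlocks 0 0 (α i) 0
  have key : γ' _ _ (liftArrow v i) =
      (T.submatrix (Subtype.val : Fibre σ τ (v.step i).1 → _)
        (Subtype.val : Fibre σ τ v.1 → _)).mulVecLin ∘ₗ θ v.1 -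
      θ (v.step i).1 ∘ₗ (T.submatrix (Subtype.val : Fibre σ τ (v.step i).1 → _)
        (Subtype.val : Fibre σ τ v.1 → _)).mulVecLin := by
    have h1 : Φ * T - T * Φ = Matrix.fromBlocks 0 0 (β i) 0 := by
      simp only [Φ, T, Matrix.fromBlocks_multiply, hc]
      ext (a | b) (a' | b') <;> simp
    have h2 : (T.submatrix (Subtype.val : Fibre σ τ (v.step i).1 → _)
        (Subtype.val : Fibre σ τ v.1 → _)).mulVecLin ∘ₗ θ v.1 -
      θ (v.step i).1 ∘ₗ (T.submatrix (Subtype.val : Fibre σ τ (v.step i).1 → _)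
        (Subtype.val : Fibre σ τ v.1 → _)).mulVecLin =
      ((Matrix.fromBlocks 0 0 (β i) 0).submatrix (Subtype.val : Fibre σ τ (v.step i).1 → _)
        (Subtype.val : Fibre σ τ v.1 → _)).mulVecLin := by
      simp only [θ]
      rw [← Matrix.mulVecLin_mul, ← Matrix.mulVecLin_mul, Matrix.mul_neg, Matrix.neg_mul,
        submatrix_mul_of_left_graded hΦ, submatrix_mul_of_right_graded hΦ, ← h1]
      ext z w
      simp
      ring
    rw [h2]
    obtain ⟨v, hv⟩ := v
    refine (Pi.basisFun k _).ext fun z => ?_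
    ext w
    obtain ⟨z | z, hz⟩ := z
    · obtain ⟨w | w, hw⟩ := w
      · exfalso
        have h3 : σ w = v.step i := hw
        have h4 := (h.even_source w).2 trivial
        rw [h3, CoverVertex.even_step] at h4
        exact h4 hv
      · have h3 : σ z = v := hz
        subst h3
        have h4 : τ w = (σ z).step i := hw
        have h5 : β i w z = _ := dif_pos h4
        simp [h5]
    · exfalso
      have h3 : τ z = v := hz
      exact (h.even_sink z).1 (h3 ▸ hv) trivial
  exact key

theorem IsExceptionalGrading.isExceptional (hx : 0 < x) (h : IsExceptionalGrading True α σ τ) :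
    IsExceptional (gradedRep α σ τ) :=
  ⟨isFiniteDimensional_gradedRep, h.indecomposable hx, h.hasNoSelfExtension⟩

end GradedRepresentation

/-! ### Push-downs of graded modules -/

section PushDownOfGraded

variable {k : Type u} [Field k] {n x y : ℕ} {α : Fin n → Matrix (Fin y) (Fin x) k}
  {σ : Fin x → CoverVertex n} {τ : Fin y → CoverVertex n}

theorem exists_directSum_basis {P : CoverVertex n → Prop} {m : ℕ} {ι : Fin m → Fin x ⊕ Fin y}
    (hι : Function.Injective ι) (hP : ∀ i, P (Sum.elim σ τ (ι i)))
    (hs : ∀ z, P (Sum.elim σ τ z) → ∃ i, ι i = z) :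
    ∃ b : Module.Basis (Fin m) k (⨁ v : {v // P v}, (Fibre σ τ v.1 → k)),
      ∀ (v : {v // P v}) (w : Fibre σ τ v.1) (i : Fin m), w.1 = ι i →
        DirectSum.lof k {v // P v} (fun v => Fibre σ τ v.1 → k) v (Pi.single w 1) = b i := by
  let e : Fin m → ⨁ v : {v // P v}, (Fibre σ τ v.1 → k) := fun i =>
    DirectSum.lof k {v // P v} (fun v => Fibre σ τ v.1 → k) ⟨Sum.elim σ τ (ι i), hP i⟩
      (Pi.single ⟨ι i, rfl⟩ 1)
  have he : ∀ (v : {v // P v}) (w : Fibre σ τ v.1) (i : Fin m), w.1 = ι i →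
      DirectSum.lof k {v // P v} (fun v => Fibre σ τ v.1 → k) v (Pi.single w 1) = e i := by
    rintro ⟨v, hv⟩ ⟨w, hw⟩ i hi
    dsimp only at hi hw
    subst hi hw
    rfl
  -- Coordinate functionals dual to `e`, used for linear independence.
  let c : Fin m → (⨁ v : {v // P v}, (Fibre σ τ v.1 → k)) →ₗ[k] k := fun j =>
    DirectSum.toModule k _ _ fun v =>
      if h : Sum.elim σ τ (ι j) = v.1 then LinearMap.proj ⟨ι j, h⟩ else 0
  have hc : ∀ i j, c j (e i) = if i = j then 1 else 0 := by
    intro i j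
    simp only [c, e, DirectSum.toModule_lof]
    by_cases h : Sum.elim σ τ (ι j) = Sum.elim σ τ (ι i)
    · rw [dif_pos h]
      simp [Pi.single_apply, hι.eq_iff, eq_comm]
    · have : i ≠ j := fun e => h (by rw [e])
      rw [dif_neg h]
      simp [this]
  have hli : LinearIndependent k e := by
    refine Fintype.linearIndependent_iff.2 fun g hg j => ?_
    simpa [hc] using congrArg (c j) hg
  have hspan : ⊤ ≤ Submodule.span k (Set.range e) := by
    rintro u -
    induction u using DirectSum.induction_on with
    | zero => exact Submodule.zero_mem _
    | add u v hu hv => exact Submodule.add_mem _ hu hv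
    | of v u =>
      change DirectSum.lof k {v // P v} (fun v => Fibre σ τ v.1 → k) v u ∈ _
      have hu : u = ∑ w, u w • Pi.single w (1 : k) := by
        ext w
        simp [Finset.sum_apply, Pi.single_apply]
      rw [hu, map_sum]
      refine Submodule.sum_mem _ fun w _ => ?_
      rw [map_smul]
      obtain ⟨i, hi⟩ := hs w.1 (by rw [w.2]; exact v.2)
      rw [he v w i hi.symm]
      exact Submodule.smul_mem _ _ (Submodule.subset_span ⟨i, rfl⟩)
  exact ⟨Module.Basis.mk hli hspan, fun v w i hi => by rw [he v w i hi, Module.Basis.mk_apply]⟩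

theorem IsExceptionalGrading.exists_pushDown_bases (h : IsExceptionalGrading True α σ τ) :
    ∃ (b : Module.Basis (Fin x) k (space (pushDown (gradedRep α σ τ)) Vertex.source))
      (c : Module.Basis (Fin y) k (space (pushDown (gradedRep α σ τ)) Vertex.sink)),
      ∀ i a, arrowMap (pushDown (gradedRep α σ τ)) (Arrow.α i : Vertex.source ⟶ Vertex.sink) (b a) =
        ∑ j, α i j a • c j := by
  have hodd : ∀ b, ¬ Even (τ b).word.length := fun b he => (h.even_sink b).1 he trivial
  obtain ⟨b, hb⟩ := exists_directSum_basis (k := k) (σ := σ) (τ := τ)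
    (P := fun v => Even v.word.length) (ι := Sum.inl) Sum.inl_injective
    (fun a => (h.even_source a).2 trivial) (by
      rintro (a | b) hz
      · exact ⟨a, rfl⟩
      · exact (hodd b hz).elim)
  obtain ⟨c, hc⟩ := exists_directSum_basis (k := k) (σ := σ) (τ := τ)
    (P := fun v => ¬ Even v.word.length) (ι := Sum.inr) Sum.inr_injective hodd (by
      rintro (a | b) hz
      · exact (hz ((h.even_source a).2 trivial)).elim
      · exact ⟨b, rfl⟩)
  refine ⟨b, c, fun i a => ?_⟩
  have h1 : arrowMap (pushDown (gradedRep α σ τ)) (Arrow.α i : Vertex.source ⟶ Vertex.sink) =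
      (pushDownMap (gradedRep α σ τ) (Arrow.α i : Vertex.source ⟶ Vertex.sink)).hom :=
    congrArg ModuleCat.Hom.hom (Paths.lift_toPath _ _)
  let v : CoverSource n := ⟨σ a, (h.even_source a).2 trivial⟩
  let z : Fibre σ τ v.1 := ⟨Sum.inl a, rfl⟩
  have h2 : b a = DirectSum.lof k (CoverSource n) (fun v => Fibre σ τ v.1 → k) v
    (Pi.single z 1) := (hb v z a rfl).symm
  let T : Matrix (Fin x ⊕ Fin y) (Fin x ⊕ Fin y) k := Matrix.fromBlocks 0 0 (α i) 0
  have h3 : arrowMap (gradedRep α σ τ) (liftArrow v i) (Pi.single z 1 : Fibre σ τ v.1 → k) =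
      ∑ w : Fibre σ τ (v.step i).1, T w.1 (Sum.inl a) • Pi.single w (1 : k) := by
    rw [arrowMap_gradedRep]
    have : ((Matrix.fromBlocks 0 0 (α i) 0).submatrix
        (Subtype.val : Fibre σ τ (v.step i).1 → _) (Subtype.val : Fibre σ τ v.1 → _)).mulVecLin
        (Pi.single z 1) =
      ∑ w : Fibre σ τ (v.step i).1, T w.1 (Sum.inl a) • Pi.single w (1 : k) := by
      ext w
      simp [Finset.sum_apply, Pi.single_apply, z, T]
    exact this
  have h4 : (pushDownMap (gradedRep α σ τ) (Arrow.α i : Vertex.source ⟶ Vertex.sink)).hom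
      (DirectSum.lof k (CoverSource n) (fun v => Fibre σ τ v.1 → k) v (Pi.single z 1)) =
      DirectSum.lof k (CoverSink n) (fun v => Fibre σ τ v.1 → k) (v.step i)
        (∑ w : Fibre σ τ (v.step i).1, T w.1 (Sum.inl a) • Pi.single w (1 : k)) := by
    rw [← h3]
    exact DirectSum.toModule_lof k (M := fun v : CoverSource n => space (gradedRep α σ τ) v.1)
      (N := ⨁ v : CoverSink n, space (gradedRep α σ τ) v.1) v _
  -- Extending `c` by zero to the source vectors allows the sum over one fibre to be enlarged to a
  -- sum over all basis vectors.
  let G : Fin x ⊕ Fin y → ⨁ v : CoverSink n, (Fibre σ τ v.1 → k) := Sum.elim 0 c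
  have h5 : DirectSum.lof k (CoverSink n) (fun v => Fibre σ τ v.1 → k) (v.step i)
        (∑ w : Fibre σ τ (v.step i).1, T w.1 (Sum.inl a) • Pi.single w (1 : k)) =
      ∑ j, α i j a • c j := by
    rw [map_sum]
    have h6 : ∀ w : Fibre σ τ (v.step i).1, DirectSum.lof k (CoverSink n)
        (fun v => Fibre σ τ v.1 → k) (v.step i) (T w.1 (Sum.inl a) • Pi.single w (1 : k)) =
        T w.1 (Sum.inl a) • G w.1 := by
      intro w
      rw [map_smul]
      obtain ⟨w | w, hw⟩ := w
      · simp [T]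
      · rw [hc _ ⟨Sum.inr w, hw⟩ w rfl]
        rfl
    rw [Finset.sum_congr rfl fun w _ => h6 w,
      sum_fibre (F := fun w => T w (Sum.inl a) • G w), Fintype.sum_sum_type]
    · simp [T, G]
    · rintro (w | w) hw
      · simp [T] at hw
      · exact h.homogeneous i w a fun h0 => hw (by simp [T, h0])
  rw [h1]
  exact (congrArg _ h2).trans (h4.trans h5)

theorem matrixIso_of_iso {N N' : QuiverRep k (Vertex n)} {α' : Fin n → Matrix (Fin y) (Fin x) k}
    {b : Module.Basis (Fin x) k (space N Vertex.source)}
    {c : Module.Basis (Fin y) k (space N Vertex.sink)}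
    (h : ∀ i a, arrowMap N (Arrow.α i : Vertex.source ⟶ Vertex.sink) (b a) = ∑ j, α i j a • c j)
    {b' : Module.Basis (Fin x) k (space N' Vertex.source)}
    {c' : Module.Basis (Fin y) k (space N' Vertex.sink)}
    (h' : ∀ i a, arrowMap N' (Arrow.α i : Vertex.source ⟶ Vertex.sink) (b' a) =
      ∑ j, α' i j a • c' j) (e : N ≅ N') : MatrixIso α α' := by
  have hα : ∀ i, LinearMap.toMatrix b c
      (arrowMap N (Arrow.α i : Vertex.source ⟶ Vertex.sink)) = α i := by
    intro i
    ext j a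
    rw [LinearMap.toMatrix_apply, h]
    simp [Finsupp.single_apply]
  have hα' : ∀ i, LinearMap.toMatrix b' c'
      (arrowMap N' (Arrow.α i : Vertex.source ⟶ Vertex.sink)) = α' i := by
    intro i
    ext j a
    rw [LinearMap.toMatrix_apply, h']
    simp [Finsupp.single_apply]
  let E : ∀ v : Vertex n, space N v ≃ₗ[k] space N' v := fun v => (e.app _).toLinearEquiv
  refine ⟨LinearMap.toMatrix b b' (E Vertex.source), LinearMap.toMatrix c c' (E Vertex.sink),
    ?_, ?_, fun i => ?_⟩
  · refine IsUnit.of_mul_eq_one (LinearMap.toMatrix b' b (E Vertex.source).symm.toLinearMap) ?_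
    rw [← LinearMap.toMatrix_comp, LinearEquiv.comp_symm, LinearMap.toMatrix_id]
  · refine IsUnit.of_mul_eq_one (LinearMap.toMatrix c' c (E Vertex.sink).symm.toLinearMap) ?_
    rw [← LinearMap.toMatrix_comp, LinearEquiv.comp_symm, LinearMap.toMatrix_id]
  · have hnat : (E Vertex.sink).toLinearMap ∘ₗ
        arrowMap N (Arrow.α i : Vertex.source ⟶ Vertex.sink) =
        arrowMap N' (Arrow.α i : Vertex.source ⟶ Vertex.sink) ∘ₗ (E Vertex.source).toLinearMap :=
      congrArg ModuleCat.Hom.hom (e.hom.naturality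
        ((Paths.of _).map (Arrow.α i : Vertex.source ⟶ Vertex.sink)))
    rw [← hα, ← hα', ← LinearMap.toMatrix_comp, ← LinearMap.toMatrix_comp, hnat]

end PushDownOfGraded

end Kronecker

theorem mainTheorem5 (k : Type u) [Field k] (n : ℕ) (x y : ℤ)
    (hxy : Kronecker.IsPositiveImaginaryRoot n x y) :
    ∃ N : Fin n → Kronecker.QuiverRep k (Kronecker.Vertex n),
      (∀ i : Fin n, Kronecker.IsCoverExceptional (N i) ∧
        ((Kronecker.dimVector (N i)).1 : ℤ) = x ∧ ((Kronecker.dimVector (N i)).2 : ℤ) = y) ∧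
      ∀ i j : Fin n, Nonempty (N i ≅ N j) → i = j := by
  obtain ⟨⟨hne, hle⟩, hreal, hx, hy⟩ := hxy
  have hq : x ^ 2 + y ^ 2 - n * x * y ≤ 0 := by
    have : x ^ 2 + y ^ 2 - n * x * y ≠ 1 := fun h => hreal ⟨⟨hne, hle⟩, h⟩
    omega
  lift x to ℕ using hx
  lift y to ℕ using hy
  have hx0 : 0 < x := by
    rcases Nat.eq_zero_or_pos x with rfl | h
    · exact (hne (by simp at hq ⊢; nlinarith)).elim
    · exact h
  have hy0 : 0 < y := by
    rcases Nat.eq_zero_or_pos y with rfl | h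
    · exact (hne (by simp at hq ⊢; nlinarith)).elim
    · exact h
  -- The parity is `True` because the sources of the covering are the words of even length.
  obtain ⟨α, σ, τ, h1, h2⟩ := Kronecker.hasExceptionalFamily (k := k) (n := n) hx0 hy0
    (by zify; linarith) True
  choose b c hbc using fun j => (h1 j).exists_pushDown_bases
  refine ⟨fun j => Kronecker.pushDown (Kronecker.gradedRep (α j) (σ j) (τ j)), fun j =>
    ⟨⟨_, (h1 j).isExceptional hx0, ⟨Iso.refl _⟩⟩, ?_, ?_⟩, ?_⟩
  · exact_mod_cast (Module.finrank_eq_card_basis (b j)).trans (Fintype.card_fin x)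
  · exact_mod_cast (Module.finrank_eq_card_basis (c j)).trans (Fintype.card_fin y)
  · rintro i j ⟨e⟩
    exact h2 i j (Kronecker.matrixIso_of_iso (hbc i) (hbc j) e)
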